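/- Let $r, n, m \ge 0$ be integers with $m \le n$, and let $W \sim \mathcal{W}_r(n, I_r)$ be a standard Wishart matrix, i.e. $W$ has the law of $XX^T$, where $X \in \mathbb{R}^{r \times n}$ has independent columns, each distributed according to the normal distribution $\mathcal{N}_r(0, I_r)$. Let $I, J, K, L \subseteq [r] = \{1, \dots, r\}$ be subsets of cardinality $m$ such that $I \triangle J = K \triangle L$, and put $$\bar I = I \setminus (I \cap J), \quad \bar J = J \setminus (I \cap J), \quad \bar K = K \setminus (K \cap L), \quad \bar L = L \setminus (K \cap L).$$ For $A, B \subseteq [r]$ and a total order on $[r]$, write $A < B$ if every element of $A$ is smaller than every element of $B$ (in particular whenever $A$ or $B$ is empty). Assume that a total order on $[r]$ (not necessarily the usual one) is given under which $$(I \cap J) \setminus (K \cap L) < \bar I, \qquad \bar I < \bar J, \qquad \bar J < (K \cap L) \setminus (I \cap J),$$ $$\bar I \cap \bar K < \bar I \cap \bar L, \qquad \bar J \cap \bar K < \bar J \cap \bar L,$$ and that the rows and columns of the submatrices $W_{I \times J}$ and $W_{K \times L}$ are listed in increasing order with respect to this total order. Then $\det(W_{I \times J}) \det(W_{K \times L})$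 is integrable and $$\mathbb{E}[\det(W_{I \times J}) \det(W_{K \times L})] = \frac{n!}{(n-m)!} \cdot \frac{(n+2)!}{(n+2 - |I \cap J \cap K \cap L|)!} \cdot \frac{(n-m + |(I \cap J) \setminus (K \cap L)|)!}{(n-m)!} \cdot |\bar I \cap \bar K|! \cdot |\bar I \cap \bar L|!.$$ -/

import Mathlib

open MeasureTheory ProbabilityTheory
open scoped Matrix Nat symmDiff

/-- Borel structure on matrices: the product σ-algebra of the entries. -/
instance Matrix.instMeasurableSpacePi {α β : Type*} : MeasurableSpace (Matrix α β ℝ) :=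
  MeasurableSpace.pi

/-- The matrix whose columns are the vectors `x 0, …, x (n - 1)`. -/
def columnMatrix {ι : Type*} {n : ℕ} (x : Fin n → EuclideanSpace ℝ ι) : Matrix ι (Fin n) ℝ :=
  Matrix.of fun i k => x k i

/-- The Wishart distribution with `n` degrees of freedom and scale parameter `S`: the law of
`X * Xᵀ`, where `X` has `n` independent columns, each distributed according to `𝒩(0, S)`. -/
noncomputable def wishart {ι : Type*} [Fintype ι] [DecidableEq ι] (n : ℕ) (S : Matrix ι ι ℝ) :
    Measure (Matrix ι ι ℝ) :=
  (Measure.pi fun _ : Fin n => multivariateGaussian (0 : EuclideanSpace ℝ ι) S).map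
    fun x => columnMatrix x * (columnMatrix x)ᵀ

/-- The minor `det (A_{I × J})`, for index sets `I`, `J` of cardinality `m`, with the rows and the
columns listed in increasing order with respect to the total order on the index type. -/
noncomputable def minor {ι : Type*} [LinearOrder ι] {m : ℕ} (A : Matrix ι ι ℝ) (I J : Finset ι)
    (hI : I.card = m) (hJ : J.card = m) : ℝ :=
  (A.submatrix (I.orderEmbOfFin hI) (J.orderEmbOfFin hJ)).det

/-- `A < B` for sets: every element of `A` is smaller than every element of `B`
(vacuously true if one of them is empty). -/
def SetLT {ι : Type*} [LinearOrder ι] (A B : Finset ι) : Prop :=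
  ∀ a ∈ A, ∀ b ∈ B, a < b

/-!
The rows of `X` are independent standard Gaussian vectors in `ℝⁿ`, and `W` is their Gram matrix.

An index lying in all four sets is conditioned on, with `v` its vector: the Schur complement of its
diagonal entry is the Gram matrix of the projections of the other vectors to the hyperplane `vᗮ`,
where they are again standard Gaussian. Both minors together give the factor `‖v‖ ^ 4`, of
expectation `n (n + 2)`, and their signs cancel because `I ∆ J = K ∆ L`. By induction on
`|I ∩ J ∩ K ∩ L|` this intersection may be assumed empty.

Then every vector that occurs in the product of the two minors occurs exactly twice, so the product
is a quadratic form in each of them, and averaging a quadratic form over the Gaussian measure gives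
the same as summing it over an orthonormal basis. With basis vectors as arguments, a Gram matrix is
a 0/1 matrix of coincidences, whose minors are signs of permutations or zero; the order conditions
make the signs cancel, and the surviving tuples are counted.
-/

section ProductMeasures

theorem measurePreserving_pi_comp {ι γ X : Type*} [Fintype ι] [Fintype γ] [MeasurableSpace X]
    (μ : Measure X) [IsProbabilityMeasure μ] {ρ : γ → ι} (hρ : ρ.Injective) :
    MeasurePreserving (fun (x : ι → X) (c : γ) => x (ρ c))
      (Measure.pi fun _ => μ) (Measure.pi fun _ => μ) := by
  refine ⟨by fun_prop, ?_⟩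
  have hindep : iIndepFun (fun c (x : ι → X) => x (ρ c)) (Measure.pi fun _ => μ) :=
    (iIndepFun_pi (X := fun _ x => x) fun _ => aemeasurable_id).precomp hρ
  rw [(iIndepFun_iff_map_fun_eq_pi_map fun c => (measurable_pi_apply _).aemeasurable).1 hindep]
  congr with c : 1
  exact (measurePreserving_eval (fun _ : ι => μ) (ρ c)).map_eq

theorem measurePreserving_pi_curry (α β : Type*) {X : Type*} [Fintype α] [Fintype β]
    [MeasurableSpace X] (μ : Measure X) [IsProbabilityMeasure μ] :
    MeasurePreserving (MeasurableEquiv.curry α β X)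
      (Measure.pi fun _ => μ) (Measure.pi fun _ => Measure.pi fun _ => μ) := by
  refine ⟨by fun_prop, ?_⟩
  simpa only [Measure.infinitePi_eq_pi] using
    Measure.infinitePi_map_curry fun (_ : α) (_ : β) => μ

theorem measurePreserving_pi_swap {ι κ X : Type*} [Fintype ι] [Fintype κ] [MeasurableSpace X]
    (μ : Measure X) [IsProbabilityMeasure μ] :
    MeasurePreserving (fun (x : κ → ι → X) i k => x k i)
      (Measure.pi fun _ => Measure.pi fun _ => μ) (Measure.pi fun _ => Measure.pi fun _ => μ) :=
  (measurePreserving_pi_curry ι κ μ).comp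
    ((measurePreserving_pi_comp μ Prod.swap_injective).comp (measurePreserving_pi_curry κ ι μ).symm)

theorem measurePreserving_pi_update {ι : Type*} [Fintype ι] [DecidableEq ι] {X : ι → Type*}
    [∀ i, MeasurableSpace (X i)] (μ : ∀ i, Measure (X i)) [∀ i, IsProbabilityMeasure (μ i)]
    (i : ι) :
    MeasurePreserving (fun p : X i × (∀ j, X j) => Function.update p.2 i p.1)
      ((μ i).prod (Measure.pi μ)) (Measure.pi μ) := by
  have hmeas : Measurable fun p : X i × (∀ j, X j) => Function.update p.2 i p.1 :=
    measurable_update'.comp measurable_swap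
  refine ⟨hmeas, (Measure.pi_eq fun s hs => ?_).symm⟩
  have hpre : (fun p : X i × (∀ j, X j) => Function.update p.2 i p.1) ⁻¹' Set.univ.pi s =
      s i ×ˢ Set.univ.pi (Function.update s i Set.univ) := by
    ext ⟨v, g⟩
    simp only [Set.mem_preimage, Set.mem_univ_pi, Set.mem_prod,
      Function.forall_update_iff g fun j y => y ∈ s j,
      Function.forall_update_iff s fun j t => g j ∈ t, Set.mem_univ, true_and]
  rw [Measure.map_apply hmeas (.univ_pi hs), hpre, Measure.prod_prod, Measure.pi_pi]
  simp_rw [Function.apply_update fun j => μ j, measure_univ]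
  rw [Finset.prod_update_of_mem (Finset.mem_univ i), one_mul, ← Finset.erase_eq,
    Finset.mul_prod_erase _ (fun j => μ j (s j)) (Finset.mem_univ i)]

variable {X κ : Type*} [MeasurableSpace X] {μ : Measure X} [IsProbabilityMeasure μ] [Fintype κ]
  {c : κ → X} {V : Set (X → ℝ)}

theorem integral_pi_fin_eq_sum_comp (hV : ∀ f ∈ V, Integrable f μ ∧ ∫ x, f x ∂μ = ∑ s, f (c s))
    {N : ℕ} {F : (Fin N → X) → ℝ} (hF : Integrable F (Measure.pi fun _ => μ))
    (hFV : ∀ g i, (fun x => F (Function.update g i x)) ∈ V) :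
    ∫ g, F g ∂(Measure.pi fun _ => μ) = ∑ f : Fin N → κ, F (c ∘ f) := by
  induction N with
  | zero =>
    rw [Measure.pi_of_empty, integral_dirac, Fintype.sum_unique]
    congr
    subsingleton
  | succ N ih =>
    have hcons := (measurePreserving_piFinSuccAbove (fun _ : Fin (N + 1) => μ) 0).symm
    have hFcons : Integrable (fun p : X × (Fin N → X) => F (Fin.cons p.1 p.2))
        (μ.prod (Measure.pi fun _ => μ)) := by
      simpa [Function.comp_def, Fin.consEquiv] using hcons.integrable_comp_of_integrable hF
    have htail : ∀ᵐ x ∂μ, ∫ g, F (Fin.cons x g) ∂(Measure.pi fun _ => μ) =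
        ∑ f : Fin N → κ, F (Fin.cons x (c ∘ f)) := by
      filter_upwards [hFcons.prod_right_ae] with x hx
      exact ih hx fun g i => by simpa only [Fin.cons_update] using hFV (Fin.cons x g) i.succ
    have hhead (f : Fin N → κ) : (fun x => F (Fin.cons x (c ∘ f))) ∈ V := by
      obtain ⟨x₀⟩ : Nonempty X := nonempty_of_isProbabilityMeasure μ
      simpa only [Fin.update_cons_zero] using hFV (Fin.cons x₀ (c ∘ f)) 0
    calc ∫ g, F g ∂(Measure.pi fun _ => μ)
        = ∫ p : X × (Fin N → X), F (Fin.cons p.1 p.2) ∂(μ.prod (Measure.pi fun _ => μ)) := by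
          rw [← hcons.integral_comp']
          simp [Fin.consEquiv]
      _ = ∫ x, ∑ f : Fin N → κ, F (Fin.cons x (c ∘ f)) ∂μ := by
          rw [integral_prod _ hFcons, integral_congr_ae htail]
      _ = ∑ s, ∑ f : Fin N → κ, F (Fin.cons (c s) (c ∘ f)) := by
          rw [integral_finsetSum _ fun f _ => (hV _ (hhead f)).1,
            Finset.sum_congr rfl fun f _ => (hV _ (hhead f)).2, Finset.sum_comm]
      _ = ∑ f : Fin (N + 1) → κ, F (c ∘ f) := by
          rw [← Fintype.sum_prod_type']
          refine Fintype.sum_equiv (Fin.consEquiv fun _ => κ) _ _ fun p => congrArg F ?_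
          exact (Fin.comp_cons c p.1 p.2).symm

theorem integral_pi_eq_sum_comp (hV : ∀ f ∈ V, Integrable f μ ∧ ∫ x, f x ∂μ = ∑ s, f (c s))
    {γ : Type*} [Fintype γ] [DecidableEq γ] {F : (γ → X) → ℝ}
    (hF : Integrable F (Measure.pi fun _ => μ))
    (hFV : ∀ g i, (fun x => F (Function.update g i x)) ∈ V) :
    ∫ g, F g ∂(Measure.pi fun _ => μ) = ∑ f : γ → κ, F (c ∘ f) := by
  let e := Fintype.equivFin γ
  have hmp := measurePreserving_pi_comp μ e.injective
  calc ∫ g, F g ∂(Measure.pi fun _ => μ)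
      = ∫ g : Fin (Fintype.card γ) → X, F (g ∘ e) ∂(Measure.pi fun _ => μ) := by
        rw [← hmp.map_eq, integral_map hmp.aemeasurable (by rw [hmp.map_eq]; exact hF.1)]
        rfl
    _ = ∑ f : Fin (Fintype.card γ) → κ, F (c ∘ f ∘ e) := by
        refine integral_pi_fin_eq_sum_comp (F := fun g => F (g ∘ e)) hV
          (hmp.integrable_comp_of_integrable hF) fun g i => ?_
        simpa only [Function.update_comp_equiv] using hFV (g ∘ e) (e.symm i)
    _ = ∑ f : γ → κ, F (c ∘ f) :=
        Fintype.sum_equiv (e.arrowCongr (Equiv.refl κ)).symm _ _ fun f => rfl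

end ProductMeasures

section GaussianMoments

theorem integrable_pow_gaussianReal (k : ℕ) : Integrable (fun x => x ^ k) (gaussianReal 0 1) :=
  ((memLp_id_gaussianReal k).integrable_norm_pow').mono' (by fun_prop)
    (ae_of_all _ fun x => (norm_pow x k).le)

theorem memLp_two_sq_gaussianReal : MemLp (fun x => x ^ 2) 2 (gaussianReal 0 1) := by
  rw [memLp_two_iff_integrable_sq (by fun_prop)]
  simpa only [← pow_mul] using integrable_pow_gaussianReal 4

theorem integral_sq_gaussianReal : ∫ x, x ^ 2 ∂(gaussianReal 0 1) = 1 := by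
  have hvar := variance_fun_id_gaussianReal (μ := 0) (v := 1)
  rw [variance_eq_integral (by fun_prop)] at hvar
  simpa using hvar

theorem map_add_gaussianReal_prod :
    ((gaussianReal 0 1).prod (gaussianReal 0 1)).map (fun p : ℝ × ℝ => p.1 + p.2) =
      (gaussianReal 0 1).map (fun x => √2 * x) := by
  have hconv := gaussianReal_conv_gaussianReal (m₁ := 0) (m₂ := 0) (v₁ := 1) (v₂ := 1)
  rw [Measure.conv] at hconv
  rw [hconv, gaussianReal_map_const_mul, zero_add, mul_zero]
  congr 1
  ext
  norm_num

theorem integral_pow_four_gaussianReal : ∫ x, x ^ 4 ∂(gaussianReal 0 1) = 3 := by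
  set γ := gaussianReal 0 1
  have hexpand : ∫ p : ℝ × ℝ, (p.1 + p.2) ^ 4 ∂(γ.prod γ) = 2 * (∫ x, x ^ 4 ∂γ) + 6 := by
    have hint (i j : ℕ) : Integrable (fun p : ℝ × ℝ => p.1 ^ i * p.2 ^ j) (γ.prod γ) :=
      (integrable_pow_gaussianReal i).mul_prod (integrable_pow_gaussianReal j)
    have hval (i j : ℕ) : ∫ p : ℝ × ℝ, p.1 ^ i * p.2 ^ j ∂(γ.prod γ) =
        (∫ x, x ^ i ∂γ) * ∫ x, x ^ j ∂γ := integral_prod_mul (fun x => x ^ i) (fun x => x ^ j)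
    have hmean : ∫ x, x ∂γ = 0 := integral_id_gaussianReal
    simp_rw [add_pow]
    rw [integral_finsetSum _ fun i _ => (hint i _).mul_const _]
    simp_rw [integral_mul_const, hval]
    simp [Finset.sum_range_succ, Nat.choose, hmean, integral_sq_gaussianReal, γ]
    ring
  -- `x + y` and `√2 x` have the same law
  have hscale : ∫ p : ℝ × ℝ, (p.1 + p.2) ^ 4 ∂(γ.prod γ) = 4 * ∫ x, x ^ 4 ∂γ := by
    have hadd : AEMeasurable (fun p : ℝ × ℝ => p.1 + p.2) (γ.prod γ) := by fun_prop
    rw [← integral_map hadd (f := fun x : ℝ => x ^ 4) (by fun_prop), map_add_gaussianReal_prod,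
      integral_map (by fun_prop) (by fun_prop)]
    simp_rw [mul_pow, integral_const_mul]
    rw [show √2 ^ 4 = (√2 ^ 2) ^ 2 by ring, Real.sq_sqrt (by norm_num)]
    norm_num [γ]
  linarith

theorem variance_sq_gaussianReal : Var[fun x => x ^ 2; gaussianReal 0 1] = 2 := by
  rw [variance_eq_sub memLp_two_sq_gaussianReal]
  simp only [Pi.pow_apply, ← pow_mul, integral_pow_four_gaussianReal, integral_sq_gaussianReal]
  norm_num

variable {E : Type*} [NormedAddCommGroup E] [InnerProductSpace ℝ E] [FiniteDimensional ℝ E]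
  [MeasurableSpace E] [BorelSpace E]

variable (E) in
theorem integral_norm_pow_four_stdGaussian :
    ∫ v, ‖v‖ ^ 4 ∂(stdGaussian E) =
      (Module.finrank ℝ E : ℝ) * (Module.finrank ℝ E + 2) := by
  rw [stdGaussian, integral_map (Measurable.aemeasurable (by fun_prop)) (by fun_prop)]
  set μ := Measure.pi fun _ : Fin (Module.finrank ℝ E) => gaussianReal 0 1
  have hmemLp (i : Fin (Module.finrank ℝ E)) : MemLp (fun x : Fin _ → ℝ => x i ^ 2) 2 μ :=
    memLp_two_sq_gaussianReal.comp_measurePreserving (measurePreserving_eval _ i)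
  have hmean : ∫ x, ∑ i, x i ^ 2 ∂μ = Module.finrank ℝ E := by
    rw [integral_finsetSum _ fun i _ => (hmemLp i).integrable (by norm_num)]
    have hi (i) : ∫ x, x i ^ 2 ∂μ = 1 := by
      rw [← integral_sq_gaussianReal]
      exact integral_comp_eval (μ := fun _ => gaussianReal 0 1) (f := fun x => x ^ 2)
        (by fun_prop)
    simp [hi]
  have hvar : Var[fun x => ∑ i, x i ^ 2; μ] = 2 * Module.finrank ℝ E := by
    have h := variance_sum_pi (μ := fun _ : Fin (Module.finrank ℝ E) => gaussianReal 0 1)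
      (X := fun _ x => x ^ 2) fun _ => memLp_two_sq_gaussianReal
    rw [Finset.sum_fn] at h
    simpa [variance_sq_gaussianReal, mul_comm] using h
  have hnorm (x : Fin (Module.finrank ℝ E) → ℝ) :
      ‖∑ i, x i • stdOrthonormalBasis ℝ E i‖ ^ 4 = (∑ i, x i ^ 2) ^ 2 := by
    rw [(stdOrthonormalBasis ℝ E).sum_repr_symm (WithLp.toLp 2 x), pow_mul _ 2 2,
      LinearIsometryEquiv.norm_map, EuclideanSpace.real_norm_sq_eq]
  rw [variance_eq_sub (memLp_finsetSum _ fun i _ => hmemLp i), hmean] at hvar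
  simp only [Pi.pow_apply] at hvar
  simp_rw [hnorm]
  linear_combination hvar

theorem integral_inner_mul_inner_stdGaussian (u v : E) :
    ∫ x, inner ℝ u x * inner ℝ v x ∂(stdGaussian E) = inner ℝ u v := by
  have hcov := covarianceBilin_apply_eq_cov (μ := stdGaussian E) IsGaussian.memLp_two_id u v
  rw [covarianceBilin_stdGaussian, innerSL_apply_apply] at hcov
  have hmean (w : E) : ∫ x, inner ℝ w x ∂(stdGaussian E) = 0 :=
    integral_strongDual_stdGaussian (innerSL ℝ w)
  simpa [covariance, hmean] using hcov.symm

theorem stdGaussian_map_orthogonalProjectionOnto (U : Submodule ℝ E) :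
    (stdGaussian E).map U.orthogonalProjectionOnto = stdGaussian U := by
  refine Measure.ext_of_charFun (funext fun t => ?_)
  rw [charFun_stdGaussian, charFun_apply, integral_map (by fun_prop) (by fun_prop)]
  simp_rw [Submodule.inner_orthogonalProjectionOnto_eq_of_mem_right]
  rw [← charFun_apply, charFun_stdGaussian, Submodule.coe_norm]

theorem measurePreserving_pi_orthogonalProjectionOnto {ι : Type*} [Fintype ι]
    (U : Submodule ℝ E) :
    MeasurePreserving (fun (g : ι → E) i => U.orthogonalProjectionOnto (g i))
      (Measure.pi fun _ => stdGaussian E) (Measure.pi fun _ => stdGaussian U) :=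
  measurePreserving_pi _ _ fun _ =>
    ⟨by fun_prop, stdGaussian_map_orthogonalProjectionOnto U⟩

end GaussianMoments

section QuadraticCubature

variable {E : Type*} [NormedAddCommGroup E] [InnerProductSpace ℝ E]

variable (E) in
/-- The linear functionals `x ↦ ⟪u, x⟫`, as a submodule of the algebra of functions on `E`; its
`d`-th power consists of the homogeneous polynomial functions of degree `d`. -/
noncomputable def innerFunctionals : Submodule ℝ (E → ℝ) :=
  LinearMap.range (LinearMap.pi fun x : E => (innerₗ E).flip x)

theorem inner_left_mem_innerFunctionals (u : E) : (fun x => inner ℝ u x) ∈ innerFunctionals E :=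
  ⟨u, rfl⟩

theorem inner_self_mem_innerFunctionals_sq [FiniteDimensional ℝ E] :
    (fun x : E => inner ℝ x x) ∈ innerFunctionals E ^ 2 := by
  let b := stdOrthonormalBasis ℝ E
  have hsum : (fun x : E => inner ℝ x x) =
      ∑ i, (fun x => inner ℝ (b i) x) * (fun x => inner ℝ (b i) x) := by
    ext x
    rw [← b.sum_inner_mul_inner x x]
    simp [real_inner_comm x]
  rw [hsum, pow_two]
  exact Submodule.sum_mem _ fun i _ => Submodule.mul_mem_mul
    (inner_left_mem_innerFunctionals _) (inner_left_mem_innerFunctionals _)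

theorem inner_update_mem_innerFunctionals_pow [FiniteDimensional ℝ E] {γ : Type*} [DecidableEq γ]
    (g : γ → E) (x i j : γ) :
    (fun y => inner ℝ (Function.update g x y i) (Function.update g x y j)) ∈
      innerFunctionals E ^ ((if i = x then 1 else 0) + if j = x then 1 else 0) := by
  by_cases hi : i = x <;> by_cases hj : j = x
  · simpa [hi, hj] using inner_self_mem_innerFunctionals_sq
  · simpa [hi, hj, real_inner_comm] using inner_left_mem_innerFunctionals (g j)
  · simpa [hi, hj] using inner_left_mem_innerFunctionals (g i)
  · simp only [Function.update_of_ne hi, Function.update_of_ne hj, hi, hj, if_false, add_zero,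
      pow_zero]
    exact Submodule.mem_one.2 ⟨inner ℝ (g i) (g j), rfl⟩

theorem det_gram_update_mem_innerFunctionals_pow [FiniteDimensional ℝ E] {γ α : Type*}
    [DecidableEq γ] [Fintype α] [DecidableEq α] (u v : α → γ) (g : γ → E) (x : γ) :
    (fun y => ((Matrix.gram ℝ (Function.update g x y)).submatrix u v).det) ∈
      innerFunctionals E ^
        ((∑ a, if u a = x then 1 else 0) + ∑ a, if v a = x then 1 else 0) := by
  have hdet : (fun y => ((Matrix.gram ℝ (Function.update g x y)).submatrix u v).det) =
      ∑ σ : Equiv.Perm α, (Equiv.Perm.sign σ : ℤ) • ∏ a, fun y =>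
        inner ℝ (Function.update g x y (u (σ a))) (Function.update g x y (v a)) := by
    ext y
    simp [Matrix.det_apply, Units.smul_def]
  rw [hdet]
  refine Submodule.sum_mem _ fun σ _ => zsmul_mem ?_ _
  rw [← Equiv.sum_comp σ, ← Finset.sum_add_distrib]
  exact SetLike.prod_mem_graded (innerFunctionals E ^ ·) _ _ fun a _ =>
    inner_update_mem_innerFunctionals_pow g x (u (σ a)) (v a)

theorem gram_comp_orthonormalBasis {κ γ : Type*} [Fintype κ] [DecidableEq κ]
    (b : OrthonormalBasis κ ℝ E) (f : γ → κ) :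
    Matrix.gram ℝ (b ∘ f) = (1 : Matrix κ κ ℝ).submatrix f f := by
  ext i j
  simp [Matrix.gram_apply, Matrix.one_apply, b.inner_eq_ite]

theorem abs_det_gram_submatrix_le {ι δ : Type*} [Fintype ι] [Fintype δ] [DecidableEq δ]
    (u v : δ → ι) (g : ι → E) :
    |((Matrix.gram ℝ g).submatrix u v).det| ≤
      (Fintype.card δ)! * ‖g‖ ^ (2 * Fintype.card δ) := by
  have hentry (i j : δ) : |inner ℝ (g (u i)) (g (v j))| ≤ ‖g‖ ^ 2 := by
    rw [sq]
    exact (abs_real_inner_le_norm _ _).trans (by gcongr <;> exact norm_le_pi_norm g _)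
  simpa [pow_mul] using Matrix.det_le (A := (Matrix.gram ℝ g).submatrix u v)
    (abv := AbsoluteValue.abs) hentry

theorem continuous_det_gram_submatrix {ι δ : Type*} [Fintype δ] [DecidableEq δ] (u v : δ → ι) :
    Continuous fun g : ι → E => ((Matrix.gram ℝ g).submatrix u v).det :=
  Continuous.matrix_det <| continuous_matrix fun i j =>
    (continuous_apply (u i)).inner (continuous_apply (v j))

variable [FiniteDimensional ℝ E] [MeasurableSpace E] [BorelSpace E]

theorem integral_stdGaussian_eq_sum_of_mem_innerFunctionals_sq {κ : Type*} [Fintype κ]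
    (b : OrthonormalBasis κ ℝ E) {f : E → ℝ} (hf : f ∈ innerFunctionals E ^ 2) :
    Integrable f (stdGaussian E) ∧ ∫ x, f x ∂(stdGaussian E) = ∑ s, f (b s) := by
  rw [pow_two] at hf
  induction hf using Submodule.mul_induction_on' with
  | mem_mul_mem f hf g hg =>
    obtain ⟨u, rfl⟩ := hf
    obtain ⟨v, rfl⟩ := hg
    have hmemLp (w : E) : MemLp (fun x => inner ℝ w x) 2 (stdGaussian E) :=
      IsGaussian.memLp_two_id.const_inner w
    refine ⟨(hmemLp u).integrable_mul (hmemLp v), ?_⟩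
    refine (integral_inner_mul_inner_stdGaussian u v).trans ?_
    rw [← b.sum_inner_mul_inner]
    exact Finset.sum_congr rfl fun s _ => by rw [real_inner_comm v]; rfl
  | add f _ g _ hf hg =>
    refine ⟨hf.1.add hg.1, ?_⟩
    simp only [Pi.add_apply]
    rw [integral_add hf.1 hg.1, hf.2, hg.2, Finset.sum_add_distrib]

section Integrability

variable {ι : Type*} [Fintype ι]

theorem integrable_norm_pow_pi_stdGaussian (k : ℕ) :
    Integrable (fun g : ι → E => ‖g‖ ^ k) (Measure.pi fun _ => stdGaussian E) := by
  have hindep : iIndepFun (fun i (g : ι → E) => g i) (Measure.pi fun _ => stdGaussian E) :=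
    iIndepFun_pi (X := fun _ x => x) fun _ => aemeasurable_id
  have hlaw (i : ι) : HasGaussianLaw (fun g : ι → E => g i) (Measure.pi fun _ => stdGaussian E) :=
    ⟨by
      rw [(measurePreserving_eval (fun _ : ι => stdGaussian E) i).map_eq]
      infer_instance⟩
  exact ((hindep.hasGaussianLaw hlaw).memLp (p := k) (by simp)).integrable_norm_pow'

theorem integrable_det_mul_det_gram {α β : Type*} [Fintype α] [DecidableEq α] [Fintype β]
    [DecidableEq β] (u v : α → ι) (w z : β → ι) :
    Integrable (fun g : ι → E => ((Matrix.gram ℝ g).submatrix u v).det *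
      ((Matrix.gram ℝ g).submatrix w z).det) (Measure.pi fun _ => stdGaussian E) := by
  refine ((integrable_norm_pow_pi_stdGaussian
    (2 * Fintype.card α + 2 * Fintype.card β)).const_mul
      ((Fintype.card α)! * (Fintype.card β)! : ℝ)).mono'
    ((continuous_det_gram_submatrix u v).mul
      (continuous_det_gram_submatrix w z)).aestronglyMeasurable (ae_of_all _ fun g => ?_)
  calc ‖((Matrix.gram ℝ g).submatrix u v).det * ((Matrix.gram ℝ g).submatrix w z).det‖
      ≤ ((Fintype.card α)! * ‖g‖ ^ (2 * Fintype.card α)) *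
          ((Fintype.card β)! * ‖g‖ ^ (2 * Fintype.card β)) := by
        rw [norm_mul]
        gcongr
        · exact abs_det_gram_submatrix_le u v g
        · exact abs_det_gram_submatrix_le w z g
    _ = (Fintype.card α)! * (Fintype.card β)! *
          ‖g‖ ^ (2 * Fintype.card α + 2 * Fintype.card β) := by ring

end Integrability

theorem integral_det_mul_det_gram {κ γ α β : Type*} [Fintype κ] [DecidableEq κ] [Fintype γ]
    [DecidableEq γ] [Fintype α] [DecidableEq α] [Fintype β] [DecidableEq β]
    (b : OrthonormalBasis κ ℝ E) (u v : α → γ) (w z : β → γ)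
    (htwice : ∀ x, ((∑ a, if u a = x then 1 else 0) + ∑ a, if v a = x then 1 else 0) +
      ((∑ c, if w c = x then 1 else 0) + ∑ c, if z c = x then 1 else 0) = 2) :
    ∫ g : γ → E, ((Matrix.gram ℝ g).submatrix u v).det * ((Matrix.gram ℝ g).submatrix w z).det
        ∂(Measure.pi fun _ => stdGaussian E) =
      ∑ f : γ → κ, ((1 : Matrix κ κ ℝ).submatrix (f ∘ u) (f ∘ v)).det *
        ((1 : Matrix κ κ ℝ).submatrix (f ∘ w) (f ∘ z)).det := by
  rw [integral_pi_eq_sum_comp (V := ↑(innerFunctionals E ^ 2)) (c := b)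
    (fun f => integral_stdGaussian_eq_sum_of_mem_innerFunctionals_sq b)
    (integrable_det_mul_det_gram u v w z) fun g x => ?_]
  · simp only [gram_comp_orthonormalBasis, Matrix.submatrix_submatrix]
  · rw [SetLike.mem_coe, ← htwice x, pow_add]
    exact Submodule.mul_mem_mul (det_gram_update_mem_innerFunctionals_pow u v g x)
      (det_gram_update_mem_innerFunctionals_pow w z g x)

end QuadraticCubature

section CoincidenceDeterminants

theorem sum_sumElim {α β κ M : Type*} [Fintype α] [DecidableEq α] [Fintype β]
    [DecidableEq β] [Fintype κ] [AddCommMonoid M] (F : (α ⊕ β → κ) → M) :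
    ∑ f, F f = ∑ a : α → κ, ∑ b : β → κ, F (Sum.elim a b) := by
  rw [← Fintype.sum_prod_type']
  exact Fintype.sum_equiv (Equiv.sumArrowEquivProdArrow α β κ) _ _ fun f =>
    congrArg F (Sum.elim_comp_inl_inr f).symm

variable {κ : Type*} [DecidableEq κ] {R : Type*} [CommRing R]

variable {α β δ : Type*} [Fintype α] [DecidableEq α] [Fintype β] [Fintype δ]

section Injections

variable [Fintype κ]

theorem sum_injective : ∑ u : α → κ, (if u.Injective then 1 else 0 : R) =
    (Fintype.card κ).descFactorial (Fintype.card α) := by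
  rw [Finset.sum_boole, ← Fintype.card_embedding_eq, ← Fintype.card_subtype]
  exact congrArg _ (Fintype.card_congr (Equiv.subtypeInjectiveEquivEmbedding α κ))

theorem sum_sumElim_injective {g : β → κ} (hg : g.Injective) :
    ∑ u : α → κ, (if (Sum.elim u g).Injective then 1 else 0 : R) =
      (Fintype.card κ - Fintype.card β).descFactorial (Fintype.card α) := by
  have hcard : Fintype.card {y // ∀ x, y ≠ g x} = Fintype.card κ - Fintype.card β := by
    rw [Fintype.card_subtype, ← Finset.card_univ (α := β),
      ← Finset.card_image_of_injective Finset.univ hg, ← Finset.card_univ_sdiff]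
    congr 1
    ext y
    simp [eq_comm]
  rw [← hcard, Finset.sum_boole, ← Fintype.card_embedding_eq, ← Fintype.card_subtype]
  refine congrArg _ (Fintype.card_congr ?_)
  exact
    { toFun := fun u => ⟨fun a => ⟨u.1 a, (Sum.elim_injective.1 u.2).2.2 a⟩,
        fun a c h => (Sum.elim_injective.1 u.2).1 (congrArg Subtype.val h)⟩
      invFun := fun e => ⟨fun a => e a, Sum.elim_injective.2
        ⟨fun a c h => e.injective (Subtype.ext h), hg, fun a => (e a).2⟩⟩ }

end Injections

variable (R) in
/-- The determinant of the 0/1 matrix recording the coincidences `u a = v c`. If `u` is injective,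
it is the sign of the permutation carrying `u` to `v`, and `0` if there is no such permutation. -/
def coincidenceDet (u v : α → κ) : R :=
  ((1 : Matrix κ κ R).submatrix u v).det

theorem coincidenceDet_comm (u v : α → κ) : coincidenceDet R u v = coincidenceDet R v u := by
  rw [coincidenceDet, ← Matrix.det_transpose, Matrix.transpose_submatrix, Matrix.transpose_one,
    coincidenceDet]

theorem injective_of_coincidenceDet_ne_zero {u v : α → κ} (h : coincidenceDet R u v ≠ 0) :
    u.Injective := by
  intro a c hac
  by_contra hne
  exact h (Matrix.det_zero_of_row_eq hne (by ext; simp [Matrix.one_apply, hac]))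

theorem exists_perm_of_coincidenceDet_ne_zero {u v : α → κ} (h : coincidenceDet R u v ≠ 0) :
    ∃ σ : Equiv.Perm α, u ∘ σ = v := by
  have hmem (c : α) : ∃ a, u a = v c := by
    by_contra! hne
    exact h (Matrix.det_eq_zero_of_column_eq_zero c fun a => Matrix.one_apply_ne (hne a))
  choose s hs using hmem
  have hv : v.Injective := injective_of_coincidenceDet_ne_zero (by rwa [coincidenceDet_comm] at h)
  have hs_inj : s.Injective := .of_comp (f := u) (by rwa [show u ∘ s = v from funext hs])
  exact ⟨.ofBijective s (Finite.injective_iff_bijective.1 hs_inj), funext hs⟩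

theorem sumElim_injective_mul_coincidenceDet (z : δ → κ) (x₁ : β → κ) (x₂ x₃ : α → κ) :
    (if (Sum.elim z (Sum.elim x₁ x₃)).Injective then 1 else 0) * coincidenceDet R x₂ x₃ =
      (if (Sum.elim z (Sum.elim x₁ x₂)).Injective then 1 else 0) * coincidenceDet R x₂ x₃ := by
  by_cases h : coincidenceDet R x₂ x₃ = 0
  · rw [h, mul_zero, mul_zero]
  · obtain ⟨σ, rfl⟩ := exists_perm_of_coincidenceDet_ne_zero h
    have hcomp : Sum.elim z (Sum.elim x₁ (x₂ ∘ σ)) = Sum.elim z (Sum.elim x₁ x₂) ∘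
        Equiv.sumCongr (.refl δ) (Equiv.sumCongr (.refl β) σ) := by
      ext (i | i | i) <;> rfl
    simp only [hcomp, Equiv.injective_comp]

theorem coincidenceDet_comp_perm {u : α → κ} (hu : u.Injective) (σ : Equiv.Perm α) :
    coincidenceDet R u (u ∘ σ) = (Equiv.Perm.sign σ : ℤ) := by
  have hone : (1 : Matrix κ κ R).submatrix u (u ∘ σ) = (1 : Matrix α α R).submatrix id σ := by
    rw [← Matrix.submatrix_one u hu, Matrix.submatrix_submatrix, Function.comp_id]
  rw [coincidenceDet, hone, Matrix.det_permute', Matrix.det_one, mul_one]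

variable [DecidableEq β]

theorem coincidenceDet_sumElim {a a' : α → κ} {b b' : β → κ} (h : ∀ x y, a x ≠ b' y) :
    coincidenceDet R (Sum.elim a b) (Sum.elim a' b') =
      coincidenceDet R a a' * coincidenceDet R b b' := by
  have hblocks : (1 : Matrix κ κ R).submatrix (Sum.elim a b) (Sum.elim a' b') =
      Matrix.fromBlocks (Matrix.submatrix 1 a a') 0 (Matrix.submatrix 1 b a')
        (Matrix.submatrix 1 b b') := by
    ext (i | i) (j | j)
    exacts [rfl, Matrix.one_apply_ne (h i j), rfl, rfl]
  rw [coincidenceDet, hblocks, Matrix.det_fromBlocks_zero₁₂, coincidenceDet, coincidenceDet]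

theorem coincidenceDet_sumElim_same (a : α → κ) (b b' : β → κ) :
    coincidenceDet R (Sum.elim a b) (Sum.elim a b') =
      (if (Sum.elim a b).Injective then 1 else 0) * coincidenceDet R b b' := by
  split_ifs with hab
  · obtain ⟨ha, -, hne⟩ := Sum.elim_injective.1 hab
    rw [coincidenceDet_comm, coincidenceDet_sumElim hne, coincidenceDet_comm b' b]
    simpa using congrArg (· * coincidenceDet R b b') (coincidenceDet_comp_perm (R := R) ha 1)
  · rw [zero_mul]
    by_contra h
    exact hab (injective_of_coincidenceDet_ne_zero h)

theorem coincidenceDet_crossed (x₁ x₄ : α → κ) (x₂ x₃ : β → κ) :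
    coincidenceDet R (Sum.elim x₁ x₂) (Sum.elim x₄ x₃) *
        coincidenceDet R (Sum.elim x₁ x₃) (Sum.elim x₄ x₂) =
      (if (Sum.elim x₁ x₂).Injective then 1 else 0) *
        (coincidenceDet R x₁ x₄ * coincidenceDet R x₂ x₃) ^ 2 := by
  split_ifs with h₁₂
  · have hne := (Sum.elim_injective.1 h₁₂).2.2
    rw [coincidenceDet_sumElim hne, coincidenceDet_comm x₃ x₂]
    by_cases h : coincidenceDet R x₁ x₄ * coincidenceDet R x₂ x₃ = 0
    · rw [h, mul_zero, zero_pow two_ne_zero, mul_zero]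
    · obtain ⟨σ, rfl⟩ := exists_perm_of_coincidenceDet_ne_zero (right_ne_zero_of_mul h)
      rw [coincidenceDet_sumElim (b' := x₂ ∘ σ) fun a c => hne a (σ c), one_mul, sq]
  · rw [zero_mul]
    by_contra h
    exact h₁₂ (injective_of_coincidenceDet_ne_zero (left_ne_zero_of_mul h))

variable [DecidableEq δ]

theorem coincidenceDet_mul_coincidenceDet (y z : δ → κ) (x₁ x₄ : α → κ) (x₂ x₃ : β → κ) :
    coincidenceDet R (Sum.elim y (Sum.elim x₁ x₂)) (Sum.elim y (Sum.elim x₄ x₃)) *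
        coincidenceDet R (Sum.elim z (Sum.elim x₁ x₃)) (Sum.elim z (Sum.elim x₄ x₂)) =
      (if (Sum.elim x₁ x₂).Injective then 1 else 0) *
        ((if (Sum.elim y (Sum.elim x₁ x₂)).Injective then 1 else 0) *
        (if (Sum.elim z (Sum.elim x₁ x₂)).Injective then 1 else 0)) *
        (coincidenceDet R x₁ x₄ ^ 2 * coincidenceDet R x₂ x₃ ^ 2) := by
  have hz := sumElim_injective_mul_coincidenceDet (R := R) z x₁ x₂ x₃
  have hcrossed := coincidenceDet_crossed (R := R) x₁ x₄ x₂ x₃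
  rw [coincidenceDet_sumElim_same, coincidenceDet_sumElim_same]
  linear_combination
    (if (Sum.elim y (Sum.elim x₁ x₂)).Injective then 1 else 0) *
      (if (Sum.elim z (Sum.elim x₁ x₃)).Injective then 1 else 0) * hcrossed +
    (if (Sum.elim y (Sum.elim x₁ x₂)).Injective then 1 else 0) *
      (if (Sum.elim x₁ x₂).Injective then 1 else 0) * coincidenceDet R x₁ x₄ ^ 2 *
      coincidenceDet R x₂ x₃ * hz

variable [Fintype κ]

theorem sum_coincidenceDet_sq {u : α → κ} (hu : u.Injective) :
    ∑ v : α → κ, coincidenceDet R u v ^ 2 = (Fintype.card α)! := by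
  have hinj : Function.Injective fun σ : Equiv.Perm α => u ∘ σ := fun σ τ h =>
    Equiv.ext fun a => hu (congrFun h a)
  have hperm (σ : Equiv.Perm α) : coincidenceDet R u (u ∘ σ) ^ 2 = 1 := by
    rw [coincidenceDet_comp_perm hu]
    exact_mod_cast congrArg (fun s : ℤ => (s : R)) (Int.isUnit_sq (Equiv.Perm.sign σ).isUnit)
  calc ∑ v : α → κ, coincidenceDet R u v ^ 2
      = ∑ σ : Equiv.Perm α, coincidenceDet R u (u ∘ σ) ^ 2 := by
        refine (Fintype.sum_of_injective _ hinj _ _ (fun v hv => ?_) fun σ => rfl).symm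
        by_contra h
        exact hv (exists_perm_of_coincidenceDet_ne_zero (ne_zero_pow two_ne_zero h))
    _ = (Fintype.card α)! := by
        simp only [hperm, Finset.sum_const, Finset.card_univ, Fintype.card_perm, nsmul_eq_mul,
          mul_one]

theorem sum_coincidenceDet_mul_coincidenceDet :
    ∑ x : α ⊕ β → κ, ∑ x₃ : β → κ, ∑ x₄ : α → κ, ∑ y : δ → κ, ∑ z : δ → κ,
      coincidenceDet R (Sum.elim y x) (Sum.elim y (Sum.elim x₄ x₃)) *
        coincidenceDet R (Sum.elim z (Sum.elim (x ∘ .inl) x₃))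
          (Sum.elim z (Sum.elim x₄ (x ∘ .inr))) =
    (Fintype.card κ).descFactorial (Fintype.card α + Fintype.card β) *
      ((Fintype.card κ - (Fintype.card α + Fintype.card β)).descFactorial (Fintype.card δ)) ^ 2 *
      (Fintype.card α)! * (Fintype.card β)! := by
  have hinner (x : α ⊕ β → κ) : ∑ x₃ : β → κ, ∑ x₄ : α → κ, ∑ y : δ → κ, ∑ z : δ → κ,
      coincidenceDet R (Sum.elim y x) (Sum.elim y (Sum.elim x₄ x₃)) *
        coincidenceDet R (Sum.elim z (Sum.elim (x ∘ .inl) x₃))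
          (Sum.elim z (Sum.elim x₄ (x ∘ .inr))) =
      (if x.Injective then 1 else 0) *
        ((Fintype.card κ - (Fintype.card α + Fintype.card β)).descFactorial (Fintype.card δ) ^ 2 *
          (Fintype.card α)! * (Fintype.card β)!) := by
    obtain ⟨x₁, x₂, rfl⟩ : ∃ x₁ x₂, x = Sum.elim x₁ x₂ :=
      ⟨x ∘ .inl, x ∘ .inr, (Sum.elim_comp_inl_inr x).symm⟩
    simp only [Sum.elim_comp_inl, Sum.elim_comp_inr, coincidenceDet_mul_coincidenceDet]
    by_cases hx : (Sum.elim x₁ x₂).Injective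
    · have hx₁ := (Sum.elim_injective.1 hx).1
      have hx₂ := (Sum.elim_injective.1 hx).2.1
      simp_rw [if_pos hx, one_mul, ← Finset.sum_mul, ← Finset.mul_sum, ← Finset.sum_mul,
        ← Finset.mul_sum]
      rw [sum_sumElim_injective hx, sum_coincidenceDet_sq hx₁, sum_coincidenceDet_sq hx₂,
        Fintype.card_sum]
      ring
    · simp only [if_neg hx, zero_mul, Finset.sum_const_zero]
  simp_rw [hinner, ← Finset.sum_mul, sum_injective, Fintype.card_sum, mul_assoc]

end CoincidenceDeterminants

section BlockIndex

/-- Index type for the case `I ∩ J ∩ K ∩ L = ∅`. Its summands stand, in order, for the blocks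
`(I \ J) ∩ (K \ L)`, `(I \ J) ∩ (L \ K)`, `(J \ I) ∩ (K \ L)`, `(J \ I) ∩ (L \ K)`, `I ∩ J` and
`K ∩ L`. -/
abbrev BlockIndex (α β δ : Type*) := (α ⊕ β) ⊕ (β ⊕ α) ⊕ (δ ⊕ δ)

namespace BlockIndex

variable {α β δ : Type*}

/-- The indices in `I`. -/
def rowsI : δ ⊕ (α ⊕ β) → BlockIndex α β δ :=
  Sum.elim (.inr ∘ .inr ∘ .inl) .inl

/-- The indices in `J`. -/
def colsJ : δ ⊕ (α ⊕ β) → BlockIndex α β δ :=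
  Sum.elim (.inr ∘ .inr ∘ .inl) (Sum.elim (.inr ∘ .inl ∘ .inr) (.inr ∘ .inl ∘ .inl))

/-- The indices in `K`. -/
def rowsK : δ ⊕ (α ⊕ β) → BlockIndex α β δ :=
  Sum.elim (.inr ∘ .inr ∘ .inr) (Sum.elim (.inl ∘ .inl) (.inr ∘ .inl ∘ .inl))

/-- The indices in `L`. -/
def colsL : δ ⊕ (α ⊕ β) → BlockIndex α β δ :=
  Sum.elim (.inr ∘ .inr ∘ .inr) (Sum.elim (.inr ∘ .inl ∘ .inr) (.inl ∘ .inr))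

variable [Fintype α] [DecidableEq α] [Fintype β] [DecidableEq β] [Fintype δ] [DecidableEq δ]

theorem occurs_twice (x : BlockIndex α β δ) :
    ((∑ a, if rowsI a = x then 1 else 0) + ∑ a, if colsJ a = x then 1 else 0) +
      ((∑ a, if rowsK a = x then 1 else 0) + ∑ a, if colsL a = x then 1 else 0) = 2 := by
  rcases x with (x | x) | (x | x) | (x | x) <;>
    simp only [rowsI, colsJ, rowsK, colsL, Fintype.sum_sum_type, Sum.elim_inl, Sum.elim_inr,
      Function.comp_apply, Sum.inl.injEq, Sum.inr.injEq, reduceCtorEq, if_false,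
      Finset.sum_const_zero, Finset.sum_ite_eq', Finset.mem_univ, if_true, zero_add, add_zero,
      Nat.reduceAdd]

theorem integral_det_mul_det_gram (E : Type*) [NormedAddCommGroup E] [InnerProductSpace ℝ E]
    [FiniteDimensional ℝ E] [MeasurableSpace E] [BorelSpace E] :
    ∫ g : BlockIndex α β δ → E, ((Matrix.gram ℝ g).submatrix rowsI colsJ).det *
        ((Matrix.gram ℝ g).submatrix rowsK colsL).det ∂(Measure.pi fun _ => stdGaussian E) =
      (Module.finrank ℝ E).descFactorial (Fintype.card α + Fintype.card β) *
        (Module.finrank ℝ E - (Fintype.card α + Fintype.card β)).descFactorial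
          (Fintype.card δ) ^ 2 * (Fintype.card α)! * (Fintype.card β)! := by
  let κ := Fin (Module.finrank ℝ E)
  have hsum := sum_coincidenceDet_mul_coincidenceDet (α := α) (β := β) (δ := δ) (κ := κ) (R := ℝ)
  rw [Fintype.card_fin] at hsum
  rw [_root_.integral_det_mul_det_gram (stdOrthonormalBasis ℝ E) _ _ _ _ occurs_twice, ← hsum,
    sum_sumElim]
  simp_rw [sum_sumElim (α := β ⊕ α), sum_sumElim (α := β), sum_sumElim (α := δ)]
  refine Finset.sum_congr rfl fun x _ => Finset.sum_congr rfl fun x₃ _ =>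
    Finset.sum_congr rfl fun x₄ _ => Finset.sum_congr rfl fun y _ =>
    Finset.sum_congr rfl fun z _ => ?_
  simp only [coincidenceDet]
  congr 3 <;> ext (i | i | i) <;> rfl

end BlockIndex

end BlockIndex

section IncreasingLists

namespace SetLT

variable {ι : Type*} [LinearOrder ι] {A B C : Finset ι}

theorem mono (h : SetLT A B) {A' B' : Finset ι} (hA : A' ⊆ A) (hB : B' ⊆ B) : SetLT A' B' :=
  fun a ha b hb => h a (hA ha) b (hB hb)

theorem union_left (hA : SetLT A C) (hB : SetLT B C) : SetLT (A ∪ B) C :=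
  fun a ha c hc => (Finset.mem_union.1 ha).elim (hA a · c hc) (hB a · c hc)

theorem trans (hAB : SetLT A B) (hBC : SetLT B C) (hB : A.Nonempty → C.Nonempty → B.Nonempty) :
    SetLT A C := fun a ha c hc =>
  let ⟨b, hb⟩ := hB ⟨a, ha⟩ ⟨c, hc⟩
  (hAB a ha b hb).trans (hBC b hb c hc)

end SetLT

/-- The family `u` lists the elements of `U` without repetition, `e a` being the position of `u a`
among the elements of `U` in increasing order. -/
structure ListsIncreasing {ι α : Type*} [LinearOrder ι] {m : ℕ} (U : Finset ι) (e : α ≃ Fin m)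
    (u : α → ι) : Prop where
  strictMono : StrictMono (u ∘ e.symm)
  mem : ∀ a, u a ∈ U
  card_eq : U.card = m

namespace ListsIncreasing

variable {ι : Type*} [LinearOrder ι] {α β : Type*} {m : ℕ} {U : Finset ι} {e : α ≃ Fin m}
  {u : α → ι}

theorem congr {V : Finset ι} {v : α → ι} (h : ListsIncreasing U e u) (hUV : U = V)
    (huv : ∀ a, u a = v a) : ListsIncreasing V e v := by
  obtain rfl := hUV
  rwa [← funext huv]

theorem orderEmbOfFin {s : ℕ} (hU : U.card = s) :
    ListsIncreasing U (Equiv.refl (Fin s)) (U.orderEmbOfFin hU) where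
  strictMono := (U.orderEmbOfFin hU).strictMono
  mem := U.orderEmbOfFin_mem hU
  card_eq := hU

theorem orderEmbOfFin_apply (h : ListsIncreasing U e u) (a : α) :
    U.orderEmbOfFin h.card_eq (e a) = u a := by
  rw [← Finset.orderEmbOfFin_unique h.card_eq (fun i => h.mem (e.symm i)) h.strictMono]
  exact congrArg u (e.symm_apply_apply a)

theorem comp_equiv (h : ListsIncreasing U e u) (σ : β ≃ α) :
    ListsIncreasing U (σ.trans e) (u ∘ σ) where
  strictMono := by
    convert h.strictMono using 1
    ext i
    simp
  mem b := h.mem (σ b)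
  card_eq := h.card_eq

theorem union {s t : ℕ} {S T : Finset ι} {e : α ≃ Fin s} {e' : β ≃ Fin t} {u : α → ι} {v : β → ι}
    (hS : ListsIncreasing S e u) (hT : ListsIncreasing T e' v) (hST : SetLT S T) (h : s + t = m) :
    ListsIncreasing (S ∪ T) ((e.sumCongr e').trans (finSumFinEquiv.trans (finCongr h)))
      (Sum.elim u v) where
  strictMono := by
    subst h
    intro i j hij
    obtain ⟨i, rfl⟩ := finSumFinEquiv.surjective i
    obtain ⟨j, rfl⟩ := finSumFinEquiv.surjective j
    rcases i with i | i <;> rcases j with j | j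
    · have hij : i < j := by
        simpa only [Fin.lt_def, finSumFinEquiv_apply_left, Fin.val_castAdd] using hij
      simpa using hS.strictMono hij
    · simpa using hST _ (hS.mem _) _ (hT.mem _)
    · simp only [Fin.lt_def, finSumFinEquiv_apply_left, finSumFinEquiv_apply_right,
        Fin.val_castAdd, Fin.val_natAdd] at hij
      omega
    · have hij : i < j := by
        simpa only [Fin.lt_def, finSumFinEquiv_apply_right, Fin.val_natAdd,
          add_lt_add_iff_left] using hij
      simpa using hT.strictMono hij
  mem := by
    rintro (a | b)
    · exact Finset.mem_union_left T (hS.mem a)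
    · exact Finset.mem_union_right S (hT.mem b)
  card_eq := by
    have hdisj : Disjoint S T := Finset.disjoint_left.2 fun x hx hx' => (hST x hx x hx').false
    rw [Finset.card_union_of_disjoint hdisj, hS.card_eq, hT.card_eq, h]

variable [Fintype α] [DecidableEq α]

theorem minor_eq {J : Finset ι} {e' : α ≃ Fin m} {v : α → ι} (hI : ListsIncreasing U e u)
    (hJ : ListsIncreasing J e' v) (M : Matrix ι ι ℝ) :
    (M.submatrix u v).det =
      (Equiv.Perm.sign (e.trans e'.symm) : ℤ) * minor M U J hI.card_eq hJ.card_eq := by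
  have hsub : M.submatrix u v = ((M.submatrix (U.orderEmbOfFin hI.card_eq)
      (J.orderEmbOfFin hJ.card_eq)).submatrix e' e').submatrix (e.trans e'.symm) id := by
    ext i j
    simp [hI.orderEmbOfFin_apply, hJ.orderEmbOfFin_apply]
  rw [hsub, Matrix.det_permute, Matrix.det_submatrix_equiv_self, minor]

theorem minor_mul_minor_eq {J K L : Finset ι} {e₁ e₂ e₃ e₄ : α ≃ Fin m} {u v w z : α → ι}
    (hI : ListsIncreasing U e₁ u) (hJ : ListsIncreasing J e₂ v) (hK : ListsIncreasing K e₃ w)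
    (hL : ListsIncreasing L e₄ z) (he : e₁.trans e₂.symm = e₃.trans e₄.symm)
    (M N : Matrix ι ι ℝ) :
    minor M U J hI.card_eq hJ.card_eq * minor N K L hK.card_eq hL.card_eq =
      (M.submatrix u v).det * (N.submatrix w z).det := by
  rw [hI.minor_eq hJ, hK.minor_eq hL, he, mul_mul_mul_comm, ← Int.cast_mul,
    ← Units.val_mul, Int.units_mul_self, Units.val_one, Int.cast_one, one_mul]

end ListsIncreasing

end IncreasingLists

section DisjointIntersections

/-- The standing assumption on the four index sets: `I ∆ J = K ∆ L`, with `∆` the symmetric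
difference, and the order conditions of the theorem. -/
structure BlockOrdered {ι : Type*} [LinearOrder ι] (I J K L : Finset ι) : Prop where
  symmDiff_eq : I ∆ J = K ∆ L
  inter_lt : SetLT ((I ∩ J) \ (K ∩ L)) (I \ J)
  sdiff_lt : SetLT (I \ J) (J \ I)
  lt_inter : SetLT (J \ I) ((K ∩ L) \ (I ∩ J))
  left_lt : SetLT ((I \ J) ∩ (K \ L)) ((I \ J) ∩ (L \ K))
  right_lt : SetLT ((J \ I) ∩ (K \ L)) ((J \ I) ∩ (L \ K))

theorem inter_sdiff_union_of_subset_symmDiff {ι : Type*} [DecidableEq ι] {S K L : Finset ι}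
    (h : S ⊆ K ∆ L) : S ∩ (K \ L) ∪ S ∩ (L \ K) = S := by
  rw [← Finset.inter_union_distrib_left]
  exact Finset.inter_eq_left.2 h

theorem card_inter_sdiff_add_of_subset_symmDiff {ι : Type*} [DecidableEq ι] {S K L : Finset ι}
    (h : S ⊆ K ∆ L) : (S ∩ (K \ L)).card + (S ∩ (L \ K)).card = S.card := by
  have hdisj : Disjoint (S ∩ (K \ L)) (S ∩ (L \ K)) :=
    disjoint_sdiff_sdiff.mono Finset.inter_subset_right Finset.inter_subset_right
  rw [← Finset.card_union_of_disjoint hdisj, inter_sdiff_union_of_subset_symmDiff h]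

namespace BlockOrdered

variable {ι : Type*} [LinearOrder ι] {I J K L : Finset ι}

theorem inter_union_blocks_I (h : BlockOrdered I J K L) :
    (I ∩ J) ∪ ((I \ J) ∩ (K \ L) ∪ (I \ J) ∩ (L \ K)) = I := by
  rw [inter_sdiff_union_of_subset_symmDiff (h.symmDiff_eq ▸ Finset.subset_union_left),
    Finset.union_comm, Finset.sdiff_union_inter]

theorem inter_union_blocks_J (h : BlockOrdered I J K L) :
    (I ∩ J) ∪ ((J \ I) ∩ (K \ L) ∪ (J \ I) ∩ (L \ K)) = J := by
  rw [inter_sdiff_union_of_subset_symmDiff (h.symmDiff_eq ▸ Finset.subset_union_right),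
    Finset.union_comm, Finset.inter_comm, Finset.sdiff_union_inter]

theorem blocks_union_inter_K (h : BlockOrdered I J K L) :
    ((I \ J) ∩ (K \ L) ∪ (J \ I) ∩ (K \ L)) ∪ (K ∩ L) = K := by
  rw [Finset.inter_comm, Finset.inter_comm (J \ I),
    inter_sdiff_union_of_subset_symmDiff (h.symmDiff_eq ▸ Finset.subset_union_left),
    Finset.sdiff_union_inter]

theorem blocks_union_inter_L (h : BlockOrdered I J K L) :
    ((I \ J) ∩ (L \ K) ∪ (J \ I) ∩ (L \ K)) ∪ (K ∩ L) = L := by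
  rw [Finset.inter_comm, Finset.inter_comm (J \ I),
    inter_sdiff_union_of_subset_symmDiff (h.symmDiff_eq ▸ Finset.subset_union_right),
    Finset.inter_comm K, Finset.sdiff_union_inter]

theorem card_blocks (h : BlockOrdered I J K L) (hJ : J.card = I.card) (hK : K.card = I.card)
    (hL : L.card = I.card) :
    ((J \ I) ∩ (K \ L)).card = ((I \ J) ∩ (L \ K)).card ∧
      ((J \ I) ∩ (L \ K)).card = ((I \ J) ∩ (K \ L)).card ∧ (K ∩ L).card = (I ∩ J).card ∧
      (I ∩ J).card + (((I \ J) ∩ (K \ L)).card + ((I \ J) ∩ (L \ K)).card) = I.card := by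
  have hIJ := card_inter_sdiff_add_of_subset_symmDiff (S := I \ J) (K := K) (L := L)
    (h.symmDiff_eq ▸ Finset.subset_union_left)
  have hJI := card_inter_sdiff_add_of_subset_symmDiff (S := J \ I) (K := K) (L := L)
    (h.symmDiff_eq ▸ Finset.subset_union_right)
  have hKL := card_inter_sdiff_add_of_subset_symmDiff (S := K \ L) (K := I) (L := J)
    (h.symmDiff_eq ▸ Finset.subset_union_left)
  rw [Finset.inter_comm, Finset.inter_comm (K \ L)] at hKL
  have hI' := Finset.card_sdiff_add_card_inter I J
  have hJ' := Finset.card_sdiff_add_card_inter J I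
  have hK' := Finset.card_sdiff_add_card_inter K L
  have hL' := Finset.card_sdiff_add_card_inter L K
  have hLK := card_inter_sdiff_add_of_subset_symmDiff (S := L \ K) (K := I) (L := J)
    (h.symmDiff_eq ▸ Finset.subset_union_right)
  rw [Finset.inter_comm, Finset.inter_comm (L \ K)] at hLK
  rw [Finset.inter_comm J] at hJ'
  rw [Finset.inter_comm L] at hL'
  omega

theorem setLT_blocks (h : BlockOrdered I J K L) (hIJ : I.card = J.card)
    (hdisj : Disjoint (I ∩ J) (K ∩ L)) :
    SetLT (I ∩ J) (I \ J) ∧ SetLT (I ∩ J) (J \ I) ∧ SetLT (I \ J) (K ∩ L) ∧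
      SetLT (J \ I) (K ∩ L) := by
  have hcard : (I \ J).card = (J \ I).card := Finset.card_sdiff_comm hIJ
  have hnonempty : (I \ J).Nonempty ↔ (J \ I).Nonempty := by
    rw [← Finset.card_pos, hcard, Finset.card_pos]
  have hI := h.inter_lt
  have hJ := h.lt_inter
  rw [Finset.sdiff_eq_self_of_disjoint hdisj] at hI
  rw [Finset.sdiff_eq_self_of_disjoint hdisj.symm] at hJ
  exact ⟨hI, hI.trans h.sdiff_lt fun _ => hnonempty.2, h.sdiff_lt.trans hJ fun hne _ =>
    hnonempty.1 hne, hJ⟩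

theorem injective_blocks {s₁ s₂ s₃ s₄ b c : ℕ} (hdisj : Disjoint (I ∩ J) (K ∩ L))
    (h₁ : ((I \ J) ∩ (K \ L)).card = s₁) (h₂ : ((I \ J) ∩ (L \ K)).card = s₂)
    (h₃ : ((J \ I) ∩ (K \ L)).card = s₃) (h₄ : ((J \ I) ∩ (L \ K)).card = s₄)
    (hB : (I ∩ J).card = b) (hC : (K ∩ L).card = c) :
    (Sum.elim
      (Sum.elim (Finset.orderEmbOfFin _ h₁) (Finset.orderEmbOfFin _ h₂))
      (Sum.elim (Sum.elim (Finset.orderEmbOfFin _ h₃) (Finset.orderEmbOfFin _ h₄))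
        (Sum.elim (Finset.orderEmbOfFin _ hB) (Finset.orderEmbOfFin _ hC)))).Injective := by
  have hne {S T : Finset ι} {s t : ℕ} (hS : S.card = s) (hT : T.card = t) (hST : Disjoint S T)
      (i : Fin s) (j : Fin t) : S.orderEmbOfFin hS i ≠ T.orderEmbOfFin hT j :=
    fun hij => Finset.disjoint_left.1 hST (S.orderEmbOfFin_mem hS i)
      (hij ▸ T.orderEmbOfFin_mem hT j)
  have hinj {S : Finset ι} {s : ℕ} (hS : S.card = s) : (S.orderEmbOfFin hS : Fin s → ι).Injective :=
    (S.orderEmbOfFin hS).injective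
  refine ((hinj _).sumElim (hinj _) (hne _ _ ?_)).sumElim
    (((hinj _).sumElim (hinj _) (hne _ _ ?_)).sumElim
      ((hinj _).sumElim (hinj _) (hne _ _ hdisj)) ?_) ?_
  · exact Finset.disjoint_left.2 fun x hx hx' => by grind
  · exact Finset.disjoint_left.2 fun x hx hx' => by grind
  · rintro (i | i) (j | j) <;>
      refine hne _ _ (Finset.disjoint_left.2 fun x hx hx' => ?_) i j <;> grind
  · rintro (i | i) ((j | j) | (j | j)) <;>
      refine hne _ _ (Finset.disjoint_left.2 fun x hx hx' => ?_) i j <;> grind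

open BlockIndex in
theorem exists_listsIncreasing (h : BlockOrdered I J K L) (hdisj : Disjoint (I ∩ J) (K ∩ L))
    (hJ : J.card = I.card) (hK : K.card = I.card) (hL : L.card = I.card) :
    ∃ (ρ : BlockIndex (Fin ((I \ J) ∩ (K \ L)).card) (Fin ((I \ J) ∩ (L \ K)).card)
        (Fin (I ∩ J).card) → ι) (e₁ e₂ e₃ e₄ : _ ≃ Fin I.card), ρ.Injective ∧
      ListsIncreasing I e₁ (ρ ∘ rowsI) ∧ ListsIncreasing J e₂ (ρ ∘ colsJ) ∧
      ListsIncreasing K e₃ (ρ ∘ rowsK) ∧ ListsIncreasing L e₄ (ρ ∘ colsL) ∧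
      e₁.trans e₂.symm = e₃.trans e₄.symm := by
  obtain ⟨hP₃, hP₄, hC, hm⟩ := h.card_blocks hJ hK hL
  obtain ⟨hBI, hBJ, hIC, hJC⟩ := h.setLT_blocks hJ.symm hdisj
  have hl {S T U : Finset ι} : S ∩ T ∪ S ∩ U ⊆ S :=
    Finset.union_subset Finset.inter_subset_left Finset.inter_subset_left
  have hPC {T U : Finset ι} : SetLT ((I \ J) ∩ T ∪ (J \ I) ∩ U) (K ∩ L) :=
    .union_left (hIC.mono Finset.inter_subset_left subset_rfl)
      (hJC.mono Finset.inter_subset_left subset_rfl)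
  have lB := ListsIncreasing.orderEmbOfFin (U := I ∩ J) rfl
  have lC := ListsIncreasing.orderEmbOfFin hC
  have l₁ := ListsIncreasing.orderEmbOfFin (U := (I \ J) ∩ (K \ L)) rfl
  have l₂ := ListsIncreasing.orderEmbOfFin (U := (I \ J) ∩ (L \ K)) rfl
  have l₃ := ListsIncreasing.orderEmbOfFin hP₃
  have l₄ := ListsIncreasing.orderEmbOfFin hP₄
  have l₁₂ := l₁.union l₂ h.left_lt rfl
  have l₃₄ := (l₃.union l₄ h.right_lt (add_comm _ _)).comp_equiv (Equiv.sumComm _ _)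
  have l₁₃ := l₁.union l₃ (h.sdiff_lt.mono Finset.inter_subset_left Finset.inter_subset_left) rfl
  have l₂₄ := (l₂.union l₄ (h.sdiff_lt.mono Finset.inter_subset_left Finset.inter_subset_left)
    (add_comm _ _)).comp_equiv (Equiv.sumComm _ _)
  have lI := lB.union l₁₂ (hBI.mono subset_rfl hl) hm
  have lJ := lB.union l₃₄ (hBJ.mono subset_rfl hl) hm
  have lK := (l₁₃.union lC hPC ((add_comm _ _).trans hm)).comp_equiv (Equiv.sumComm _ _)
  have lL := (l₂₄.union lC hPC ((add_comm _ _).trans hm)).comp_equiv (Equiv.sumComm _ _)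
  exact ⟨_, _, _, _, _, injective_blocks hdisj rfl rfl hP₃ hP₄ rfl hC,
    lI.congr h.inter_union_blocks_I (by rintro (a | a) <;> rfl),
    lJ.congr h.inter_union_blocks_J (by rintro (a | a | a) <;> rfl),
    lK.congr h.blocks_union_inter_K (by rintro (a | a | a) <;> rfl),
    lL.congr h.blocks_union_inter_L (by rintro (a | a | a) <;> rfl), by ext (a | a) <;> simp⟩

theorem integral_minor_gram_mul_minor_gram_of_disjoint (E : Type*) [NormedAddCommGroup E]
    [InnerProductSpace ℝ E] [FiniteDimensional ℝ E] [MeasurableSpace E] [BorelSpace E] [Fintype ι]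
    {m : ℕ} (h : BlockOrdered I J K L) (hdisj : Disjoint (I ∩ J) (K ∩ L)) (hI : I.card = m)
    (hJ : J.card = m) (hK : K.card = m) (hL : L.card = m) :
    ∫ x : ι → E, minor (Matrix.gram ℝ x) I J hI hJ * minor (Matrix.gram ℝ x) K L hK hL
        ∂(Measure.pi fun _ => stdGaussian E) =
      (Module.finrank ℝ E).descFactorial
          (((I \ J) ∩ (K \ L)).card + ((I \ J) ∩ (L \ K)).card) *
        (Module.finrank ℝ E - (((I \ J) ∩ (K \ L)).card +
          ((I \ J) ∩ (L \ K)).card)).descFactorial (I ∩ J).card ^ 2 *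
        ((I \ J) ∩ (K \ L)).card ! * ((I \ J) ∩ (L \ K)).card ! := by
  subst hI
  obtain ⟨ρ, e₁, e₂, e₃, e₄, hρ, lI, lJ, lK, lL, he⟩ := h.exists_listsIncreasing hdisj hJ hK hL
  have hminor (x : ι → E) := lI.minor_mul_minor_eq lJ lK lL he (Matrix.gram ℝ x) (Matrix.gram ℝ x)
  have hmp := measurePreserving_pi_comp (stdGaussian E) hρ
  simp_rw [hminor]
  have hbase := BlockIndex.integral_det_mul_det_gram (α := Fin ((I \ J) ∩ (K \ L)).card)
    (β := Fin ((I \ J) ∩ (L \ K)).card) (δ := Fin (I ∩ J).card) E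
  simp only [Fintype.card_fin] at hbase
  rw [← hbase]
  exact hmp.hasLaw.integral_comp (f := fun g : _ → E =>
    ((Matrix.gram ℝ g).submatrix BlockIndex.rowsI BlockIndex.colsJ).det *
      ((Matrix.gram ℝ g).submatrix BlockIndex.rowsK BlockIndex.colsL).det)
    (integrable_det_mul_det_gram _ _ _ _).aestronglyMeasurable

end BlockOrdered

end DisjointIntersections

section SchurComplement

/-- The Schur complement of the diagonal entry `A x x`. The index `x` is kept, so that the row and
the column of `x` vanish if `A x x ≠ 0`. -/
def schurComplement {ι R : Type*} [Field R] (A : Matrix ι ι R) (x : ι) : Matrix ι ι R :=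
  Matrix.of fun i j => A i j - A i x * A x j / A x x

theorem det_eq_mul_det_schur {R : Type*} [Field R] {k : ℕ}
    (A : Matrix (Fin (k + 1)) (Fin (k + 1)) R) (i j : Fin (k + 1)) (h : A i j ≠ 0) :
    A.det = (-1) ^ (i + j : ℕ) * A i j * (Matrix.of fun a c => A (i.succAbove a) (j.succAbove c) -
      A (i.succAbove a) j * A i (j.succAbove c) / A i j).det := by
  let B : Matrix (Fin (k + 1)) (Fin (k + 1)) R :=
    Matrix.of fun a c => if a = i then A i c else A a c - A a j * A i c / A i j
  have hAB : A.det = B.det := by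
    refine Matrix.det_eq_of_forall_row_eq_smul_add_const
      (fun a => if a = i then 0 else A a j / A i j) i (by simp) fun a c => ?_
    by_cases ha : a = i
    · subst ha; simp [B]
    · simp [B, ha]; ring
  rw [hAB, Matrix.det_succ_column B j, Finset.sum_eq_single i]
  · congr 2
    · simp [B]
    · ext a c
      simp [B]
  · intro a _ ha
    simp [B, ha, h]
  · simp

theorem even_card_filter_of_symmDiff_eq {ι : Type*} [DecidableEq ι] {I J K L : Finset ι}
    (h : I ∆ J = K ∆ L) (p : ι → Prop) [DecidablePred p] :
    Even ((I.filter p).card + (J.filter p).card + ((K.filter p).card + (L.filter p).card)) := by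
  have hcard (S T : Finset ι) : (S.filter p).card + (T.filter p).card =
      ((S ∆ T).filter p).card + 2 * ((S ∩ T).filter p).card := by
    have hsymm : (S ∆ T).filter p = (S.filter p \ T.filter p) ∪ (T.filter p \ S.filter p) := by
      ext y
      simp only [Finset.mem_filter, Finset.mem_symmDiff, Finset.mem_union, Finset.mem_sdiff]
      tauto
    rw [hsymm, Finset.card_union_of_disjoint disjoint_sdiff_sdiff, Finset.filter_inter_distrib]
    have hS := Finset.card_sdiff_add_card_inter (S.filter p) (T.filter p)
    have hT := Finset.card_sdiff_add_card_inter (T.filter p) (S.filter p)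
    rw [Finset.inter_comm] at hT
    omega
  rw [hcard I J, hcard K L, h]
  exact ⟨((K ∆ L).filter p).card + ((I ∩ J).filter p).card + ((K ∩ L).filter p).card, by ring⟩

theorem card_erase_of_card_eq_succ {ι : Type*} [DecidableEq ι] {S : Finset ι} {k : ℕ}
    (hS : S.card = k + 1) {x : ι} (hx : x ∈ S) : (S.erase x).card = k := by
  rw [Finset.card_erase_of_mem hx, hS, Nat.add_sub_cancel]

variable {ι : Type*} [LinearOrder ι]

theorem exists_orderEmbOfFin_eq {S : Finset ι} {k : ℕ} (hS : S.card = k) {x : ι} (hx : x ∈ S) :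
    ∃ i, S.orderEmbOfFin hS i = x := by
  rwa [← Set.mem_range, Finset.range_orderEmbOfFin]

theorem orderEmbOfFin_succAbove {S : Finset ι} {k : ℕ} (hS : S.card = k + 1) {x : ι}
    {i : Fin (k + 1)} (hi : S.orderEmbOfFin hS i = x) (hx : (S.erase x).card = k) (a : Fin k) :
    S.orderEmbOfFin hS (i.succAbove a) = (S.erase x).orderEmbOfFin hx a := by
  subst hi
  refine congrFun (Finset.orderEmbOfFin_unique hx (f := S.orderEmbOfFin hS ∘ i.succAbove)
    (fun a => ?_) ?_) a
  · exact Finset.mem_erase.2 ⟨by simp, S.orderEmbOfFin_mem hS _⟩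
  · exact (S.orderEmbOfFin hS).strictMono.comp (Fin.strictMono_succAbove i)

theorem card_filter_lt_orderEmbOfFin {S : Finset ι} {k : ℕ} (hS : S.card = k) (i : Fin k) :
    (S.filter (· < S.orderEmbOfFin hS i)).card = i := by
  conv_lhs => enter [1, 2]; rw [← S.map_orderEmbOfFin_univ hS]
  rw [Finset.filter_map, Finset.card_map]
  simp only [Function.comp_def, RelEmbedding.coe_toEmbedding, OrderEmbedding.lt_iff_lt,
    Finset.filter_gt_eq_Iio, Fin.card_Iio]

theorem minor_congr {M N : Matrix ι ι ℝ} {I J : Finset ι} (h : ∀ i ∈ I, ∀ j ∈ J, M i j = N i j)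
    {m : ℕ} (hI : I.card = m) (hJ : J.card = m) : minor M I J hI hJ = minor N I J hI hJ := by
  refine congrArg Matrix.det (Matrix.ext fun i j => ?_)
  exact h _ (I.orderEmbOfFin_mem hI i) _ (J.orderEmbOfFin_mem hJ j)

theorem minor_eq_zero_of_row_eq_zero {M : Matrix ι ι ℝ} {x : ι} (hM : ∀ j, M x j = 0)
    {I J : Finset ι} {m : ℕ} (hI : I.card = m) (hJ : J.card = m) (hxI : x ∈ I) :
    minor M I J hI hJ = 0 := by
  obtain ⟨i, hi⟩ := exists_orderEmbOfFin_eq hI hxI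
  exact Matrix.det_eq_zero_of_row_eq_zero i fun j => by simp [hi, hM]

theorem minor_eq_mul_minor_schurComplement {M : Matrix ι ι ℝ} {x : ι} (hM : M x x ≠ 0)
    {I J : Finset ι} {k : ℕ} (hI : I.card = k + 1) (hJ : J.card = k + 1) (hxI : x ∈ I)
    (hxJ : x ∈ J) :
    minor M I J hI hJ = (-1) ^ ((I.filter (· < x)).card + (J.filter (· < x)).card) * M x x *
      minor (schurComplement M x) (I.erase x) (J.erase x) (card_erase_of_card_eq_succ hI hxI)
        (card_erase_of_card_eq_succ hJ hxJ) := by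
  obtain ⟨i, hi⟩ := exists_orderEmbOfFin_eq hI hxI
  obtain ⟨j, hj⟩ := exists_orderEmbOfFin_eq hJ hxJ
  have hpivot : M.submatrix (I.orderEmbOfFin hI) (J.orderEmbOfFin hJ) i j = M x x := by
    rw [Matrix.submatrix_apply, hi, hj]
  have hcardI := card_filter_lt_orderEmbOfFin hI i
  have hcardJ := card_filter_lt_orderEmbOfFin hJ j
  rw [hi] at hcardI
  rw [hj] at hcardJ
  rw [minor, det_eq_mul_det_schur _ i j (by rwa [hpivot]), hpivot, hcardI, hcardJ, minor]
  congr 2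
  ext a c
  simp only [Matrix.of_apply, Matrix.submatrix_apply, schurComplement, hi, hj,
    orderEmbOfFin_succAbove hI hi (card_erase_of_card_eq_succ hI hxI),
    orderEmbOfFin_succAbove hJ hj (card_erase_of_card_eq_succ hJ hxJ)]

theorem minor_mul_minor_eq_mul_minor_schurComplement {M : Matrix ι ι ℝ} {x : ι} (hM : M x x ≠ 0)
    {I J K L : Finset ι} (h : I ∆ J = K ∆ L) {k : ℕ} (hI : I.card = k + 1) (hJ : J.card = k + 1)
    (hK : K.card = k + 1) (hL : L.card = k + 1) (hxI : x ∈ I) (hxJ : x ∈ J) (hxK : x ∈ K)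
    (hxL : x ∈ L) :
    minor M I J hI hJ * minor M K L hK hL = M x x ^ 2 *
      (minor (schurComplement M x) (I.erase x) (J.erase x) (card_erase_of_card_eq_succ hI hxI)
          (card_erase_of_card_eq_succ hJ hxJ) *
        minor (schurComplement M x) (K.erase x) (L.erase x) (card_erase_of_card_eq_succ hK hxK)
          (card_erase_of_card_eq_succ hL hxL)) := by
  have hsign := (even_card_filter_of_symmDiff_eq h (· < x)).neg_one_pow (α := ℝ)
  rw [pow_add] at hsign
  rw [minor_eq_mul_minor_schurComplement hM hI hJ hxI hxJ,
    minor_eq_mul_minor_schurComplement hM hK hL hxK hxL, mul_mul_mul_comm, mul_mul_mul_comm (_ ^ _),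
    hsign, one_mul, ← sq]

end SchurComplement

section Conditioning

theorem schurComplement_gram {E ι : Type*} [NormedAddCommGroup E] [InnerProductSpace ℝ E]
    (g : ι → E) (x : ι) :
    schurComplement (Matrix.gram ℝ g) x =
      Matrix.gram ℝ fun i => (ℝ ∙ g x)ᗮ.orthogonalProjectionOnto (g i) := by
  ext i j
  have hproj : ((ℝ ∙ g x)ᗮ.orthogonalProjectionOnto (g j) : E) =
      g j - (inner ℝ (g x) (g j) / ‖g x‖ ^ 2) • g x := by
    rw [Submodule.coe_orthogonalProjectionOnto_apply, Submodule.starProjection_orthogonal_val,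
      Submodule.starProjection_singleton, RCLike.ofReal_real_eq_id, id]
  rw [Matrix.gram_apply, Submodule.inner_orthogonalProjectionOnto_eq_of_mem_right, hproj,
    inner_sub_right, inner_smul_right, ← real_inner_self_eq_norm_sq, schurComplement,
    Matrix.of_apply]
  simp only [Matrix.gram_apply]
  ring

theorem minor_gram_comp_update_erase {ι X E : Type*} [LinearOrder ι] [NormedAddCommGroup E]
    [InnerProductSpace ℝ E] (f : X → E) (v : X) (g : ι → X) {I J : Finset ι} {x : ι} {m : ℕ}
    (hI : (I.erase x).card = m) (hJ : (J.erase x).card = m) :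
    minor (Matrix.gram ℝ fun i => f (Function.update g x v i)) (I.erase x) (J.erase x) hI hJ =
      minor (Matrix.gram ℝ fun i => f (g i)) (I.erase x) (J.erase x) hI hJ :=
  minor_congr (fun i hi j hj => by
    rw [Matrix.gram_apply, Matrix.gram_apply, Function.update_of_ne (Finset.ne_of_mem_erase hi),
      Function.update_of_ne (Finset.ne_of_mem_erase hj)]) hI hJ

variable {ι : Type*} [LinearOrder ι] {E : Type*} [NormedAddCommGroup E] [InnerProductSpace ℝ E]
  {I J K L : Finset ι} {k : ℕ} {x : ι}

theorem minor_gram_mul_minor_gram_eq (h : I ∆ J = K ∆ L) (hI : I.card = k + 1)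
    (hJ : J.card = k + 1) (hK : K.card = k + 1) (hL : L.card = k + 1) (hxI : x ∈ I) (hxJ : x ∈ J)
    (hxK : x ∈ K) (hxL : x ∈ L) {g : ι → E} {v : E} (hv : g x = v) :
    minor (Matrix.gram ℝ g) I J hI hJ * minor (Matrix.gram ℝ g) K L hK hL = ‖v‖ ^ 4 *
      (minor (Matrix.gram ℝ fun i => (ℝ ∙ v)ᗮ.orthogonalProjectionOnto (g i)) (I.erase x)
          (J.erase x) (card_erase_of_card_eq_succ hI hxI) (card_erase_of_card_eq_succ hJ hxJ) *
        minor (Matrix.gram ℝ fun i => (ℝ ∙ v)ᗮ.orthogonalProjectionOnto (g i)) (K.erase x)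
          (L.erase x) (card_erase_of_card_eq_succ hK hxK) (card_erase_of_card_eq_succ hL hxL)) := by
  subst hv
  have hxx : Matrix.gram ℝ g x x = ‖g x‖ ^ 2 := real_inner_self_eq_norm_sq (g x)
  rcases eq_or_ne (g x) 0 with hx | hx
  · have hrow (j : ι) : Matrix.gram ℝ g x j = 0 := by rw [Matrix.gram_apply, hx, inner_zero_left]
    rw [minor_eq_zero_of_row_eq_zero hrow hI hJ hxI, zero_mul, hx, norm_zero,
      zero_pow four_ne_zero, zero_mul]
  · have hpivot : Matrix.gram ℝ g x x ≠ 0 := by rwa [hxx, ne_eq, sq_eq_zero_iff, norm_eq_zero]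
    rw [minor_mul_minor_eq_mul_minor_schurComplement hpivot h hI hJ hK hL hxI hxJ hxK hxL,
      schurComplement_gram, hxx, ← pow_mul]

variable [Fintype ι] [FiniteDimensional ℝ E] [MeasurableSpace E] [BorelSpace E]

theorem integral_minor_gram_mul_minor_gram_of_erase (h : I ∆ J = K ∆ L) (hI : I.card = k + 1)
    (hJ : J.card = k + 1) (hK : K.card = k + 1) (hL : L.card = k + 1) (hxI : x ∈ I) (hxJ : x ∈ J)
    (hxK : x ∈ K) (hxL : x ∈ L) {c : ℝ}
    (hc : ∀ v : E, v ≠ 0 → ∫ g : ι → (ℝ ∙ v)ᗮ,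
      minor (Matrix.gram ℝ g) (I.erase x) (J.erase x) (card_erase_of_card_eq_succ hI hxI)
          (card_erase_of_card_eq_succ hJ hxJ) *
        minor (Matrix.gram ℝ g) (K.erase x) (L.erase x) (card_erase_of_card_eq_succ hK hxK)
          (card_erase_of_card_eq_succ hL hxL) ∂(Measure.pi fun _ => stdGaussian (ℝ ∙ v)ᗮ) = c) :
    ∫ g : ι → E, minor (Matrix.gram ℝ g) I J hI hJ * minor (Matrix.gram ℝ g) K L hK hL
      ∂(Measure.pi fun _ => stdGaussian E) =
    (Module.finrank ℝ E : ℝ) * (Module.finrank ℝ E + 2) * c := by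
  let F (g : ι → E) : ℝ := minor (Matrix.gram ℝ g) I J hI hJ * minor (Matrix.gram ℝ g) K L hK hL
  have hint : Integrable F (Measure.pi fun _ => stdGaussian E) :=
    integrable_det_mul_det_gram _ _ _ _
  have hmp := measurePreserving_pi_update (fun _ : ι => stdGaussian E) x
  have hcond (v : E) : ∫ g, F (Function.update g x v) ∂(Measure.pi fun _ => stdGaussian E) =
      ‖v‖ ^ 4 * c := by
    have hproj := measurePreserving_pi_orthogonalProjectionOnto (ι := ι) (ℝ ∙ v)ᗮ
    have hschur (g : ι → E) := minor_gram_mul_minor_gram_eq h hI hJ hK hL hxI hxJ hxK hxL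
      (Function.update_self x v g)
    simp only [minor_gram_comp_update_erase] at hschur
    simp only [F, hschur, integral_const_mul]
    rcases eq_or_ne v 0 with rfl | hv
    · rw [norm_zero, zero_pow four_ne_zero, zero_mul, zero_mul]
    · rw [← hc v hv]
      congr 1
      exact hproj.hasLaw.integral_comp
        (f := fun g => minor (Matrix.gram ℝ g) _ _ _ _ * minor (Matrix.gram ℝ g) _ _ _ _)
        (integrable_det_mul_det_gram (E := (ℝ ∙ v)ᗮ) _ _ _ _).aestronglyMeasurable
  calc ∫ g, F g ∂(Measure.pi fun _ => stdGaussian E)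
      = ∫ p : E × (ι → E), F (Function.update p.2 x p.1)
          ∂((stdGaussian E).prod (Measure.pi fun _ => stdGaussian E)) :=
        (hmp.hasLaw.integral_comp hint.aestronglyMeasurable).symm
    _ = ∫ v, ‖v‖ ^ 4 * c ∂(stdGaussian E) := by
        exact (integral_prod _ (hmp.integrable_comp_of_integrable hint)).trans
          (integral_congr_ae (ae_of_all _ hcond))
    _ = Module.finrank ℝ E * (Module.finrank ℝ E + 2) * c := by
        rw [integral_mul_const, integral_norm_pow_four_stdGaussian]

end Conditioning

section Induction

theorem erase_sdiff_erase_of_mem {ι : Type*} [DecidableEq ι] {S T : Finset ι} {x : ι}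
    (hx : x ∈ T) : S.erase x \ T.erase x = S \ T := by
  rw [← Finset.erase_sdiff_distrib, Finset.erase_eq_of_notMem fun h => (Finset.mem_sdiff.1 h).2 hx]

theorem descFactorial_mul_sq_sub_eq (d b s : ℕ) :
    d.descFactorial s * (d - s).descFactorial b ^ 2 =
      d.descFactorial (b + s) * (d - (b + s) + b).descFactorial b := by
  rcases le_or_gt (b + s) d with h | h
  · rw [show d - (b + s) + b = d - s by lia, sq, ← mul_assoc, mul_comm (d.descFactorial s),
      ← Nat.descFactorial_mul_descFactorial (Nat.le_add_left s b), Nat.add_sub_cancel]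
  · rw [Nat.descFactorial_eq_zero_iff_lt.2 h, zero_mul]
    rcases lt_or_ge d s with hs | hs
    · rw [Nat.descFactorial_eq_zero_iff_lt.2 hs, zero_mul]
    · rw [Nat.descFactorial_eq_zero_iff_lt.2 (by lia : d - s < b), zero_pow two_ne_zero, mul_zero]

theorem finrank_orthogonal_span_singleton {E : Type*} [NormedAddCommGroup E]
    [InnerProductSpace ℝ E] [FiniteDimensional ℝ E] {v : E} (hv : v ≠ 0) :
    Module.finrank ℝ (ℝ ∙ v)ᗮ = Module.finrank ℝ E - 1 := by
  rw [← (ℝ ∙ v).finrank_add_finrank_orthogonal, finrank_span_singleton hv, Nat.add_sub_cancel_left]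

theorem mul_descFactorial_pred (d k a : ℕ) :
    d * (d + 2) * ((d - 1).descFactorial k * (d - 1 + 2).descFactorial a) =
      d.descFactorial (k + 1) * (d + 2).descFactorial (a + 1) := by
  rcases d with _ | d
  · rw [Nat.zero_descFactorial_succ, zero_mul, zero_mul, zero_mul]
  · rw [Nat.add_sub_cancel, Nat.succ_descFactorial_succ, Nat.succ_descFactorial_succ (d + 2)]
    ring

namespace BlockOrdered

variable {ι : Type*} [LinearOrder ι] {I J K L : Finset ι}

theorem erase (h : BlockOrdered I J K L) {x : ι} (hxI : x ∈ I) (hxJ : x ∈ J) (hxK : x ∈ K)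
    (hxL : x ∈ L) : BlockOrdered (I.erase x) (J.erase x) (K.erase x) (L.erase x) where
  symmDiff_eq := by
    simpa only [symmDiff, Finset.sup_eq_union, erase_sdiff_erase_of_mem, hxI, hxJ, hxK, hxL]
      using h.symmDiff_eq
  inter_lt := by
    simpa only [Finset.inter_erase, Finset.erase_inter, Finset.erase_idem,
      erase_sdiff_erase_of_mem, Finset.mem_inter, and_self, hxI, hxJ, hxK, hxL] using h.inter_lt
  sdiff_lt := by
    simpa only [erase_sdiff_erase_of_mem, hxI, hxJ] using h.sdiff_lt
  lt_inter := by
    simpa only [Finset.inter_erase, Finset.erase_inter, Finset.erase_idem,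
      erase_sdiff_erase_of_mem, Finset.mem_inter, and_self, hxI, hxJ, hxK, hxL] using h.lt_inter
  left_lt := by
    simpa only [erase_sdiff_erase_of_mem, hxI, hxJ, hxK, hxL] using h.left_lt
  right_lt := by
    simpa only [erase_sdiff_erase_of_mem, hxI, hxJ, hxK, hxL] using h.right_lt

theorem integral_minor_gram_mul_minor_gram (E : Type*) [NormedAddCommGroup E]
    [InnerProductSpace ℝ E] [FiniteDimensional ℝ E] [MeasurableSpace E] [BorelSpace E] [Fintype ι]
    {m : ℕ} (h : BlockOrdered I J K L) (hI : I.card = m) (hJ : J.card = m) (hK : K.card = m)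
    (hL : L.card = m) :
    ∫ x : ι → E, minor (Matrix.gram ℝ x) I J hI hJ * minor (Matrix.gram ℝ x) K L hK hL
        ∂(Measure.pi fun _ => stdGaussian E) =
      ((Module.finrank ℝ E).descFactorial m *
        (Module.finrank ℝ E + 2).descFactorial (I ∩ J ∩ K ∩ L).card *
        (Module.finrank ℝ E - m + ((I ∩ J) \ (K ∩ L)).card).descFactorial
          ((I ∩ J) \ (K ∩ L)).card *
        ((I \ J) ∩ (K \ L)).card ! * ((I \ J) ∩ (L \ K)).card ! : ℕ) := by
  induction ha : (I ∩ J ∩ K ∩ L).card generalizing E m I J K L with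
  | zero =>
    have hdisj : Disjoint (I ∩ J) (K ∩ L) := by
      rwa [Finset.disjoint_iff_inter_eq_empty, ← Finset.inter_assoc, ← Finset.card_eq_zero]
    have hm := (h.card_blocks (hJ.trans hI.symm) (hK.trans hI.symm) (hL.trans hI.symm)).2.2.2
    rw [h.integral_minor_gram_mul_minor_gram_of_disjoint E hdisj hI hJ hK hL,
      Finset.sdiff_eq_self_of_disjoint hdisj, Nat.descFactorial_zero, mul_one, ← hI, ← hm,
      ← descFactorial_mul_sq_sub_eq]
    push_cast
    rfl
  | succ a ih =>
    obtain ⟨x, hx⟩ : (I ∩ J ∩ K ∩ L).Nonempty := Finset.card_pos.1 (by lia)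
    simp only [Finset.mem_inter] at hx
    obtain ⟨⟨⟨hxI, hxJ⟩, hxK⟩, hxL⟩ := hx
    obtain ⟨k, rfl⟩ : ∃ k, m = k + 1 :=
      Nat.exists_eq_succ_of_ne_zero (hI ▸ (Finset.card_pos.2 ⟨x, hxI⟩).ne')
    have hcard : (I.erase x ∩ J.erase x ∩ K.erase x ∩ L.erase x).card = a := by
      simp only [Finset.inter_erase, Finset.erase_inter, Finset.erase_idem]
      exact card_erase_of_card_eq_succ ha (by simp [*])
    have hc (v : E) := ih (ℝ ∙ v)ᗮ (h.erase hxI hxJ hxK hxL)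
      (card_erase_of_card_eq_succ hI hxI) (card_erase_of_card_eq_succ hJ hxJ)
      (card_erase_of_card_eq_succ hK hxK) (card_erase_of_card_eq_succ hL hxL) hcard
    have hsdiff : (I.erase x ∩ J.erase x) \ (K.erase x ∩ L.erase x) = (I ∩ J) \ (K ∩ L) := by
      simp only [Finset.inter_erase, Finset.erase_inter, Finset.erase_idem,
        erase_sdiff_erase_of_mem, Finset.mem_inter, hxK, hxL, and_self]
    simp only [hsdiff, erase_sdiff_erase_of_mem, hxJ, hxK, hxL] at hc
    rw [integral_minor_gram_mul_minor_gram_of_erase h.symmDiff_eq hI hJ hK hL hxI hxJ hxK hxL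
      fun v hv => (hc v).trans (by rw [finrank_orthogonal_span_singleton hv]),
      ← mul_descFactorial_pred, Nat.add_comm k 1, ← Nat.sub_sub]
    push_cast
    ring

end BlockOrdered

end Induction

section Wishart

theorem measurePreserving_toLp_pi_gaussianReal (ι : Type*) [Fintype ι] :
    MeasurePreserving (MeasurableEquiv.toLp 2 (ι → ℝ)) (Measure.pi fun _ => gaussianReal 0 1)
      (stdGaussian (EuclideanSpace ℝ ι)) :=
  ⟨by fun_prop, map_pi_eq_stdGaussian⟩

theorem measurePreserving_toLp_swap_pi_stdGaussian (ι κ : Type*) [Fintype ι] [Fintype κ] :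
    MeasurePreserving
      (fun (x : κ → EuclideanSpace ℝ ι) (i : ι) =>
        (WithLp.toLp 2 fun k => x k i : EuclideanSpace ℝ κ))
      (Measure.pi fun _ => stdGaussian (EuclideanSpace ℝ ι))
      (Measure.pi fun _ => stdGaussian (EuclideanSpace ℝ κ)) :=
  (measurePreserving_pi _ _ fun _ : ι => measurePreserving_toLp_pi_gaussianReal κ).comp
    ((measurePreserving_pi_swap (gaussianReal 0 1)).comp
      (measurePreserving_pi _ _ fun _ : κ => (measurePreserving_toLp_pi_gaussianReal ι).symm))

theorem columnMatrix_mul_transpose {ι : Type*} {n : ℕ} (x : Fin n → EuclideanSpace ℝ ι) :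
    columnMatrix x * (columnMatrix x)ᵀ =
      Matrix.gram ℝ fun i => (WithLp.toLp 2 fun k => x k i : EuclideanSpace ℝ (Fin n)) := by
  ext i j
  simp [Matrix.mul_apply, columnMatrix, Matrix.gram_apply, PiLp.inner_apply, mul_comm]

theorem measurable_matrix_entry {α β : Type*} (i : α) (j : β) :
    Measurable fun A : Matrix α β ℝ => A i j :=
  (measurable_pi_apply j).comp (measurable_pi_apply i)

theorem measurable_minor {ι : Type*} [LinearOrder ι] {m : ℕ} (I J : Finset ι) (hI : I.card = m)
    (hJ : J.card = m) : Measurable fun A : Matrix ι ι ℝ => minor A I J hI hJ := by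
  simp only [minor, Matrix.det_apply', Matrix.submatrix_apply]
  exact Finset.measurable_fun_sum _ fun σ _ =>
    (Finset.measurable_fun_prod _ fun i _ => measurable_matrix_entry _ _).const_mul _

theorem measurable_gram {ι E : Type*} [NormedAddCommGroup E] [InnerProductSpace ℝ E]
    [MeasurableSpace E] [OpensMeasurableSpace E] [SecondCountableTopology E] :
    Measurable (Matrix.gram ℝ : (ι → E) → Matrix ι ι ℝ) :=
  measurable_pi_iff.2 fun i => measurable_pi_iff.2 fun j =>
    (measurable_pi_apply i).inner (measurable_pi_apply j)

theorem hasLaw_gram_wishart (ι : Type*) [Fintype ι] [DecidableEq ι] (n : ℕ) :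
    HasLaw (Matrix.gram ℝ) (wishart n (1 : Matrix ι ι ℝ))
      (Measure.pi fun _ : ι => stdGaussian (EuclideanSpace ℝ (Fin n))) where
  aemeasurable := measurable_gram.aemeasurable
  map_eq := by
    have hrows := measurePreserving_toLp_swap_pi_stdGaussian ι (Fin n)
    rw [wishart, multivariateGaussian_zero_one, ← hrows.map_eq,
      Measure.map_map measurable_gram hrows.measurable]
    exact congrArg (Measure.map · _) (funext fun x => (columnMatrix_mul_transpose x).symm)

theorem integrable_minor_mul_minor_wishart {ι : Type*} [Fintype ι] [LinearOrder ι] (n : ℕ)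
    {I J K L : Finset ι} {k m : ℕ} (hI : I.card = k) (hJ : J.card = k) (hK : K.card = m)
    (hL : L.card = m) :
    Integrable (fun A => minor A I J hI hJ * minor A K L hK hL)
      (wishart n (1 : Matrix ι ι ℝ)) := by
  have hmeas : Measurable fun A => minor A I J hI hJ * minor A K L hK hL :=
    (measurable_minor I J hI hJ).mul (measurable_minor K L hK hL)
  have hlaw := hasLaw_gram_wishart ι n
  rw [← hlaw.map_eq, integrable_map_measure hmeas.aestronglyMeasurable hlaw.aemeasurable]
  exact integrable_det_mul_det_gram _ _ _ _

theorem BlockOrdered.integral_minor_mul_minor_wishart {ι : Type*} [Fintype ι] [LinearOrder ι]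
    {I J K L : Finset ι} (h : BlockOrdered I J K L) (n : ℕ) {m : ℕ} (hI : I.card = m)
    (hJ : J.card = m) (hK : K.card = m) (hL : L.card = m) :
    ∫ A, minor A I J hI hJ * minor A K L hK hL ∂(wishart n (1 : Matrix ι ι ℝ)) =
      (n.descFactorial m * (n + 2).descFactorial (I ∩ J ∩ K ∩ L).card *
        (n - m + ((I ∩ J) \ (K ∩ L)).card).descFactorial ((I ∩ J) \ (K ∩ L)).card *
        ((I \ J) ∩ (K \ L)).card ! * ((I \ J) ∩ (L \ K)).card ! : ℕ) := by
  have hgram := h.integral_minor_gram_mul_minor_gram (EuclideanSpace ℝ (Fin n)) hI hJ hK hL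
  rw [finrank_euclideanSpace_fin] at hgram
  rw [← hgram]
  exact ((hasLaw_gram_wishart ι n).integral_comp
    (integrable_minor_mul_minor_wishart n hI hJ hK hL).aestronglyMeasurable).symm

theorem cast_descFactorial_eq_factorial_div {n k : ℕ} (h : k ≤ n) :
    (n.descFactorial k : ℝ) = n ! / (n - k)! := by
  rw [← Nat.factorial_mul_descFactorial h, Nat.cast_mul,
    mul_div_cancel_left₀ _ (Nat.cast_ne_zero.2 (Nat.factorial_ne_zero _))]

theorem cast_factorial_add_div (n k : ℕ) : ((n + k)! : ℝ) / n ! = (n + k).descFactorial k := by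
  rw [cast_descFactorial_eq_factorial_div (Nat.le_add_left k n), Nat.add_sub_cancel]

end Wishart

theorem theorem4p5 {ι : Type*} [Fintype ι] [LinearOrder ι]
    {Ω : Type*} [MeasurableSpace Ω] (P : Measure Ω) [IsProbabilityMeasure P]
    (n m : ℕ) (hmn : m ≤ n)
    (W : Ω → Matrix ι ι ℝ) (hW : HasLaw W (wishart n (1 : Matrix ι ι ℝ)) P)
    (I J K L : Finset ι)
    (hI : I.card = m) (hJ : J.card = m) (hK : K.card = m) (hL : L.card = m)
    (hIJKL : I ∆ J = K ∆ L)
    (I' J' K' L' : Finset ι)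
    (hI' : I' = I \ (I ∩ J)) (hJ' : J' = J \ (I ∩ J))
    (hK' : K' = K \ (K ∩ L)) (hL' : L' = L \ (K ∩ L))
    (h₁ : SetLT ((I ∩ J) \ (K ∩ L)) I') (h₂ : SetLT I' J')
    (h₃ : SetLT J' ((K ∩ L) \ (I ∩ J)))
    (h₄ : SetLT (I' ∩ K') (I' ∩ L')) (h₅ : SetLT (J' ∩ K') (J' ∩ L')) :
    Integrable (fun ω => minor (W ω) I J hI hJ * minor (W ω) K L hK hL) P ∧
    ∫ ω, minor (W ω) I J hI hJ * minor (W ω) K L hK hL ∂P =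
      ((n)! : ℝ) / ((n - m)! : ℝ)
        * (((n + 2)! : ℝ) / ((n + 2 - (I ∩ J ∩ K ∩ L).card)! : ℝ))
        * (((n - m + ((I ∩ J) \ (K ∩ L)).card)! : ℝ) / ((n - m)! : ℝ))
        * ((I' ∩ K').card ! : ℝ) * ((I' ∩ L').card ! : ℝ) := by
  subst hI' hJ' hK' hL'
  simp only [Finset.sdiff_inter_self_left, Finset.sdiff_inter_self_right] at h₁ h₂ h₃ h₄ h₅ ⊢
  have hblocks : BlockOrdered I J K L := ⟨hIJKL, h₁, h₂, h₃, h₄, h₅⟩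
  have hint := integrable_minor_mul_minor_wishart n hI hJ hK hL
  refine ⟨(hW.map_eq ▸ hint).comp_aemeasurable hW.aemeasurable, ?_⟩
  have ha : (I ∩ J ∩ K ∩ L).card ≤ n + 2 := calc
    (I ∩ J ∩ K ∩ L).card ≤ L.card := Finset.card_le_card Finset.inter_subset_right
    _ ≤ n + 2 := by lia
  calc ∫ ω, minor (W ω) I J hI hJ * minor (W ω) K L hK hL ∂P
      = ∫ A, minor A I J hI hJ * minor A K L hK hL ∂(wishart n 1) :=
        hW.integral_comp hint.aestronglyMeasurable
    _ = _ := hblocks.integral_minor_mul_minor_wishart n hI hJ hK hL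
    _ = _ := by
      rw [← cast_descFactorial_eq_factorial_div hmn, ← cast_descFactorial_eq_factorial_div ha,
        cast_factorial_add_div]
      push_cast
      rfl
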